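/- **Input.** Let $m\ge 2$ and let $A_1,\dots,A_m$ be finite sets. Put $A=A_1\cup\dots\cup A_m$, and let $T(x)$ be the number of indices $i$ with $x\in A_i$. Let $\alpha_L,\alpha_R,\beta_L,\beta_R\in[0,1)$. Each $A_i$ comes with a number $m_i\in[(1-\beta_L)|A_i|,(1+\beta_R)|A_i|]$ and a random generator $\mathrm{RandomElement}(A_i)$, which returns elements of $A_i$, each with probability in $[\frac{1-\alpha_L}{|A_i|},\frac{1+\alpha_R}{|A_i|}]$. Membership queries "$x\in A_i$?" can also be asked. Let $M=m_1+\dots+m_m$. A *random choice* selects $i$ with probability $m_i/M$ and calls $\mathrm{RandomElement}(A_i)$. Let $\epsilon,\gamma\in(0,1)$ and $c_1\ge 0$, and let $z_{\min},z_{\max}$ be integers with $1\le z_{\min}\le\min_{x\in A}T(x)\le\max_{x\in A}T(x)\le z_{\max}\le m$. **Parameters** ($\log=\log_2$). Let $\epsilon_0=\frac{\epsilon}{9}$, $\epsilon_1=\frac{\epsilon_0}{6\log m}$, $\epsilon_2=\frac{\epsilon_1}{4}$, $\epsilon_3=\frac{\epsilon_0}{3}$, $\delta=\frac{\epsilon_2}{2}$,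 $\gamma_2=\frac{\gamma}{6\log m}$. Let $v$ be the number of integers $i\ge 1$ such that $[(1+\delta)^{i-1},(1+\delta)^i)$ meets $[z_{\min},z_{\max}]$. Let $$f_1=8m^{c_1},\quad f_2=\frac{2v}{\epsilon_3}+\frac{2\log (m/z_{\min})}{\epsilon_3\log(1+\delta)},\quad f_3=f_1\cdot\frac{6\ln(2/\gamma_2)}{\epsilon_2^2},\quad f_4=\frac{f_2\log (m^2/\epsilon_1)}{6\epsilon_1^2}+\frac{f_3}{\epsilon_2f_1},$$ $$f_5=\frac{m f_4}{z_{\min}},\quad \gamma_3=\frac{\gamma_2}{2f_5},\quad f_6=f_1\cdot\frac{24}{\epsilon_1^2}\ln\frac{2}{\gamma_3},\quad \rho=\frac{\log(z_{\max}/z_{\min})}{\log f_1}.$$ **Algorithm ApproximateUnion.** Let $h_1=\lceil f_5\rceil$, $t_1=z_{\max}$, $t_{i+1}=t_i/f_1$, $s_i=m/t_i$, $u_i=\lceil s_if_6\rceil$, and $h_{i+1}=\lceil h_1/s_{i+1}\rceil$ for $i\ge1$. Let $R_1$ be a multiset of $n_1$ independent random choices, where $n_1$ is an integer with $\lceil h_1/s_1\rceil\le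 n_1\le h_1$ (the standard choice is $n_1=h_1$). Let $s_1'=1/n_1$ and $sum=0$. Stage $i=1,2,\dots$ does the following. 1. Select a multiset $H_i$ of $u_i$ independent uniform indices from $\{1,\dots,m\}$. For each $x\in R_i$, query all sets with index in $H_i$, and let $S(x,H_i)$ be the number of $k\in H_i$ (with multiplicity) with $x\in A_k$. 2. Let $V_i$ consist of the $x\in R_i$ with $S(x,H_i)\ge\frac{t_i}{2f_1m}u_i$. Add $s_i'\sum_{x\in V_i}\frac{u_i}{S(x,H_i)\,m}$ to $sum$. 3. If $|R_i|-|V_i|<h_{i+1}$, let $R_{i+1}=R_i-V_i$ and $a_i=1$. Otherwise let $R_{i+1}$ consist of $h_{i+1}$ independent uniform samples from $R_i-V_i$ and let $a_i=(|R_i|-|V_i|)/h_{i+1}$. Let $s_{i+1}'=s_i'a_i$. 4. If $t_{i+1}<z_{\min}$, return $sum\cdot M$; otherwise go to stage $i+1$. **Cost.** Each elementary operation on real numbers or memory, each selection of an index with probability $m_i/M$ or uniformly, each call of $\mathrm{RandomElement}$ and each membership query takes one unit of time. In one round the algorithm sends any number of requests to generators and membership queries simultaneously and receives all answers. **Theorem.**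 There is an absolute constant $C>0$ such that for all inputs as above and every integer $n_1$ with $\lceil h_1/s_1\rceil\le n_1\le h_1$: * With probability at least $1-\gamma$, $$sum\cdot M\in\big[(1-\epsilon)(1-\alpha_L)(1-\beta_L)\,|A|,\ (1+\epsilon)(1+\alpha_R)(1+\beta_R)\,|A|\big].$$ * The number of rounds is always at most $C\max\{1,\rho\}$. * The running time is always at most $C\cdot\frac{m f_4f_6}{z_{\min}}\max\{\frac{m}{z_{\max}},\rho\}$. If $n_1=\lceil h_1/s_1\rceil$ (which equals $h_1$ when $z_{\max}=m$), it is always at most $C\cdot\frac{m f_4f_6}{z_{\min}}\max\{1,\rho\}$. -/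

import Mathlib

open scoped ENNReal

noncomputable section

/-! ## Lists of sets with approximate sizes and biased random generators -/

/-- `p` is an `(αL, αR)`-biased random generator of the finite set `A`: it returns elements of `A`,
each with probability in `[(1 - αL) / |A|, (1 + αR) / |A|]`. -/
def IsBiasedGenerator {X : Type*} (αL αR : ℝ) (A : Finset X) (p : PMF X) : Prop :=
  p.support ⊆ (A : Set X) ∧
    ∀ x ∈ A, (1 - αL) / (A.card : ℝ) ≤ (p x).toReal ∧ (p x).toReal ≤ (1 + αR) / (A.card : ℝ)

/-- An `((αL, αR), (βL, βR))`-list of `m` finite sets: each set comes with an approximate size and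
with a biased random generator. -/
structure ApproxList (m : ℕ) (X : Type*) (αL αR βL βR : ℝ) where
  set : Fin m → Finset X
  size : Fin m → ℝ
  gen : Fin m → PMF X
  αL_mem : αL ∈ Set.Ico (0 : ℝ) 1
  αR_mem : αR ∈ Set.Ico (0 : ℝ) 1
  βL_mem : βL ∈ Set.Ico (0 : ℝ) 1
  βR_mem : βR ∈ Set.Ico (0 : ℝ) 1
  le_size : ∀ i, (1 - βL) * ((set i).card : ℝ) ≤ size i
  size_le : ∀ i, size i ≤ (1 + βR) * ((set i).card : ℝ)
  biased : ∀ i, IsBiasedGenerator αL αR (set i) (gen i)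

namespace ApproxList

variable {m : ℕ} {X : Type*} {αL αR βL βR : ℝ} (L : ApproxList m X αL αR βL βR)

/-- `M = m_1 + ⋯ + m_m`, the sum of the approximate sizes. -/
def M : ℝ := ∑ i, L.size i

open Classical in
/-- `A_1 ∪ ⋯ ∪ A_m`. -/
def union : Finset X := Finset.univ.biUnion L.set

open Classical in
/-- `T(x, L)`, the number of sets of the list that contain `x`. -/
def thickness (x : X) : ℕ := (Finset.univ.filter fun i => x ∈ L.set i).card

/-- The least thickness of an element of the union (which is never empty for `m ≥ 1`). -/
def minThickness : ℕ := sInf (L.thickness '' (L.union : Set X))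

/-- The largest thickness of an element of the union. -/
def maxThickness : ℕ := L.union.sup L.thickness

theorem size_pos (i : Fin m) : 0 < L.size i := by
  obtain ⟨x, hx⟩ := (L.gen i).support_nonempty
  have hA : (0 : ℝ) < ((L.set i).card : ℝ) := by
    exact_mod_cast Finset.card_pos.mpr ⟨x, (L.biased i).1 hx⟩
  have hb : 0 < 1 - βL := by linarith [L.βL_mem.2]
  exact lt_of_lt_of_le (mul_pos hb hA) (L.le_size i)

theorem M_pos [NeZero m] : 0 < L.M :=
  Finset.sum_pos (fun i _ => L.size_pos i) Finset.univ_nonempty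

theorem sum_pick [NeZero m] : ∑ i, ENNReal.ofReal (L.size i / L.M) = 1 := by
  rw [← ENNReal.ofReal_sum_of_nonneg fun i _ => div_nonneg (L.size_pos i).le L.M_pos.le,
    ← Finset.sum_div, show ∑ i, L.size i = L.M from rfl, div_self L.M_pos.ne',
    ENNReal.ofReal_one]

/-- The distribution that selects the index `i` with probability `m_i / M`. -/
def pick [NeZero m] : PMF (Fin m) :=
  PMF.ofFintype (fun i => ENNReal.ofReal (L.size i / L.M)) L.sum_pick

/-- The joint law of independent answers to a list of requests `RandomElement(A_i)`. -/
def genBatch : List (Fin m) → PMF (List X)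
  | [] => PMF.pure []
  | i :: is => (L.gen i).bind fun x => (genBatch is).bind fun xs => PMF.pure (x :: xs)

open Classical in
/-- The answers to a batch of membership queries: the entry `(x, [i₁, …, i_k])` asks for
`query(x, A_{i₁}), …, query(x, A_{i_k})`. -/
def answers (qs : List (X × List (Fin m))) : List (List Bool) :=
  qs.map fun q => q.2.map fun i => decide (q.1 ∈ L.set i)

end ApproxList

/-! ## The machine model: randomized server programs with black-box access to the sets -/

/-- Programs of a server that has access to `m` sets of elements of `X` only through rounds of
requests. The instructions are: return a value; do a number of elementary local operations (real
arithmetic, comparisons, access to memory); select an index `i` with probability `m_i / M`; draw a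
uniform random number below `n`; and carry out one round, in which a list of requests
`RandomElement(A_i)` and a batch of membership queries are sent simultaneously, so that no request
of a round can depend on an answer of the same round. -/
inductive Prog (m : ℕ) (X : Type*) (α : Type*)
  | ret (a : α)
  | work (steps : ℕ) (next : Prog m X α)
  | pickSet (next : Fin m → Prog m X α)
  | uniform (n : ℕ) [NeZero n] (next : Fin n → Prog m X α)
  | round (gens : List (Fin m)) (qs : List (X × List (Fin m)))
      (next : List X → List (List Bool) → Prog m X α)

/-- The result of a run: the value returned, the running time and the number of rounds. -/
structure Outcome (α : Type*) where
  value : α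
  time : ℕ
  rounds : ℕ

/-- Add running time and rounds to an outcome. -/
def Outcome.add {α : Type*} (t r : ℕ) (o : Outcome α) : Outcome α :=
  ⟨o.value, t + o.time, r + o.rounds⟩

namespace Prog

variable {m : ℕ} {X α β : Type*}

/-- Sequential composition. -/
def bind : Prog m X α → (α → Prog m X β) → Prog m X β
  | ret a, f => f a
  | work k p, f => work k (p.bind f)
  | pickSet p, f => pickSet fun i => (p i).bind f
  | uniform n p, f => uniform n fun j => (p j).bind f
  | round g q p, f => round g q fun xs bs => (p xs bs).bind f

/-- Run `p` independently `n` times and collect the results; each turn of the loop costs one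
operation on top of the cost of `p`. -/
def times (p : Prog m X α) : ℕ → Prog m X (List α)
  | 0 => ret []
  | n + 1 => work 1 (p.bind fun a => (times p n).bind fun as => ret (a :: as))

/-- `n` independent uniform random samples from a list with multiplicities. -/
def resample : List X → ℕ → Prog m X (List X)
  | [], _ => ret []
  | x :: xs, n => times (uniform (xs.length + 1) fun j => ret ((x :: xs).get j)) n

/-- The law of the outcome of a program on the list `L`. Each elementary operation, each random
number, each request `RandomElement(A_i)` and each membership query takes one unit of time. -/
def run [NeZero m] {αL αR βL βR : ℝ} (L : ApproxList m X αL αR βL βR) :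
    Prog m X α → PMF (Outcome α)
  | ret a => PMF.pure ⟨a, 0, 0⟩
  | work k p => (run L p).map (Outcome.add k 0)
  | pickSet p => L.pick.bind fun i => (run L (p i)).map (Outcome.add 1 0)
  | uniform n p => (PMF.uniformOfFintype (Fin n)).bind fun j =>
      (run L (p j)).map (Outcome.add 1 0)
  | round g q p => (L.genBatch g).bind fun xs =>
      (run L (p xs (L.answers q))).map
        (Outcome.add (g.length + (q.map fun r => r.2.length).sum) 1)

end Prog

/-! ## The parameters of the algorithm -/

/-- The input parameters `z_min`, `z_max`, `ε`, `γ` of the algorithm for `m` sets, and the exponent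
`c₁` in `f₁(m) = 8 m ^ c₁`. -/
structure Params (m : ℕ) where
  zmin : ℕ
  zmax : ℕ
  ε : ℝ
  γ : ℝ
  c₁ : ℝ
  two_le_m : 2 ≤ m
  one_le_zmin : 1 ≤ zmin
  zmin_le_zmax : zmin ≤ zmax
  zmax_le : zmax ≤ m
  ε_mem : ε ∈ Set.Ioo (0 : ℝ) 1
  γ_mem : γ ∈ Set.Ioo (0 : ℝ) 1
  c₁_nonneg : 0 ≤ c₁

/-- The number of classes `[(1 + δ)^i, (1 + δ)^(i+1))`, `i = 0, 1, 2, …`, of the thickness scale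
that meet `[z₁, z₂]`. -/
def classCount (δ z₁ z₂ : ℝ) : ℕ :=
  Set.ncard {i : ℕ | ∃ t : ℝ, z₁ ≤ t ∧ t ≤ z₂ ∧ (1 + δ) ^ i ≤ t ∧ t < (1 + δ) ^ (i + 1)}

namespace Params

variable {m : ℕ} (P : Params m)

def ε₀ : ℝ := P.ε / 9
def ε₁ : ℝ := P.ε₀ / (6 * Real.logb 2 m)
def ε₂ : ℝ := P.ε₁ / 4
def ε₃ : ℝ := P.ε₀ / 3
def δ : ℝ := P.ε₂ / 2
def γ₂ : ℝ := P.γ / (6 * Real.logb 2 m)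
def f₁ : ℝ := 8 * (m : ℝ) ^ P.c₁
def f₂ : ℝ := 2 * (classCount P.δ P.zmin P.zmax : ℝ) / P.ε₃
  + 2 * Real.logb 2 ((m : ℝ) / P.zmin) / (P.ε₃ * Real.logb 2 (1 + P.δ))
def f₃ : ℝ := P.f₁ * (6 * Real.log (2 / P.γ₂) / P.ε₂ ^ 2)
def f₄ : ℝ := P.f₂ * Real.logb 2 ((m : ℝ) ^ 2 / P.ε₁) / (6 * P.ε₁ ^ 2) + P.f₃ / (P.ε₂ * P.f₁)
def f₅ : ℝ := m * P.f₄ / P.zmin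
def γ₃ : ℝ := P.γ₂ / (2 * P.f₅)
def f₆ : ℝ := P.f₁ * (24 / P.ε₁ ^ 2 * Real.log (2 / P.γ₃))

/-- `h₁`, the value `f₅(m)` rounded up. -/
def h₁ : ℕ := ⌈P.f₅⌉₊

/-- The bound `h₁ / s` (rounded up) for the number of samples kept at the value `s = m / t`, where
`t` is the current thickness. -/
def sampleBound (t : ℝ) : ℕ := ⌈(P.h₁ : ℝ) / ((m : ℝ) / t)⌉₊

/-- `log (z_max / z_min) / log f₁(m)`, which governs the number of stages. -/
def stageRatio : ℝ := Real.log ((P.zmax : ℝ) / P.zmin) / Real.log P.f₁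

theorem eight_le_f₁ : 8 ≤ P.f₁ := by
  have hm : (1 : ℝ) ≤ (m : ℝ) := by exact_mod_cast le_trans (by norm_num) P.two_le_m
  have := Real.one_le_rpow hm P.c₁_nonneg
  unfold f₁
  linarith

theorem floor_lt {t : ℝ} (h : ¬ t / P.f₁ < P.zmin) : ⌊t / P.f₁⌋₊ < ⌊t⌋₊ := by
  have h8 := P.eight_le_f₁
  have h1 : (1 : ℝ) ≤ t / P.f₁ :=
    le_trans (by exact_mod_cast P.one_le_zmin) (not_lt.mp h)
  have h2 : t = t / P.f₁ * P.f₁ := by field_simp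
  rw [← Nat.add_one_le_iff, Nat.le_floor_iff (by rw [h2]; positivity)]
  have h3 := Nat.floor_le (zero_le_one.trans h1)
  push_cast
  nlinarith

end Params

/-! ## The algorithm -/

namespace Prog

variable {m : ℕ} [NeZero m] {X : Type*}

open Classical in
/-- One stage of the algorithm and all later ones. `R` is the current sample (with
multiplicities), `t` the current thickness, `w` the current weight `s'` of a sample point and
`sum` the value accumulated so far. -/
def stage (P : Params m) (R : List X) (t w sum : ℝ) : Prog m X ℝ :=
  -- compute `s = m / t` and `u = s f₆(m)`, and select `u` random indices
  work 4 <| (times (uniform m ret) ⌈(m : ℝ) / t * P.f₆⌉₊).bind fun H =>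
  -- prepare the `|R| u` queries, ask them all in one round and count the positive answers `S(x, H)`
  work (R.length * H.length) <| round [] (R.map fun x => (x, H)) fun _ rows =>
  work (R.length * H.length) <|
  let scored : List (X × ℕ) := R.zip (rows.map fun row => row.count true)
  -- compute the threshold of the stage, and split the sample into `V` and `R - V`
  work (5 + 3 * R.length) <|
  let threshold : ℝ := t / (2 * P.f₁ * m) * H.length
  let V : List (X × ℕ) := scored.filter fun p => decide (threshold ≤ (p.2 : ℝ))
  let rest : List X := (scored.filter fun p => decide ((p.2 : ℝ) < threshold)).map Prod.fst
  -- add the contribution of `V` to the sum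
  work (3 + 3 * V.length) <|
  let sum' : ℝ := sum + w * (V.map fun p => (H.length : ℝ) / ((p.2 : ℝ) * m)).sum
  -- update the thickness, compute the new sample bound and shrink the sample if it is larger
  work 5 <|
  let h : ℕ := P.sampleBound (t / P.f₁)
  (if rest.length < h then ret (rest, (1 : ℝ))
    else (resample rest h).bind fun R' => work 1 <| ret (R', (rest.length : ℝ) / h)).bind fun Ra =>
  -- update the weight, test for termination
  work 2 <|
  if _ht : t / P.f₁ < P.zmin then ret sum'
  else stage P Ra.1 (t / P.f₁) (w * Ra.2) sum'
termination_by ⌊t⌋₊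
decreasing_by exact P.floor_lt _ht

/-- Algorithm ApproximateUnion, started with `n₁` random choices of elements of the list. It uses
the input sets only through `RandomElement` and membership queries; the sum `M` of the approximate
sizes is part of the input. -/
def approximateUnion (P : Params m) (M : ℝ) (n₁ : ℕ) : Prog m X ℝ :=
  -- evaluate the parameters
  work 100 <|
  -- one round for the first sample: `n₁` random choices of the list
  (times (pickSet ret) n₁).bind fun is => round is [] fun R _ =>
  (stage P R P.zmax (1 / (n₁ : ℝ)) 0).bind fun sum =>
  work 1 <| ret (sum * M)

end Prog

end

/-! A random choice returns `x` with probability `T(x) / M`, up to the bias factors. Hence `M` times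
the mean of `1 / T(x)` counts every element of the union once and equals `|A|` up to these factors
(`M_mul_meanInv_mem`). The algorithm estimates this mean, and each of its approximations is
controlled by Chernoff's bound.

Sampling: on a population with thickness in `[z_min, t]` the variable `z_min / T` lies in `[0, 1]`
and has mean at least `z_min / t`. A sample of size about `h₁ t / m` therefore has expected sum at
least `f₄`, whatever `t` is, and preserves the mean of `1 / T` within `1 ± ε₂` except with
probability `γ₂` (`iid_invSum_tail`). Only the second summand of `f₄` is needed here; the thickness
classes play no role.

Scores: for a fixed sample, the `u ≥ (m / t) f₆` random indices estimate every thickness above `t /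
(4 f₁)` within `1 ± ε₁` and keep thinner elements below the threshold (`badScore_le`). So accepted
elements are well estimated, and rejected ones have thickness below `t / f₁`, which is what the next
stage requires.

The conserved quantity is `sum + w * invSum R`, with `w` the weight of a sample point. Each
resampling multiplies its second term by `1 ± ε₂`, while the factor `1 / (1 ± ε₁)` is paid only
once, because an accepted element leaves the sample. There are at most `⌊ρ⌋ + 1` stages, and `f₁ ≥
8` gives `ρ ≤ log m / 3`, so the errors and failure probabilities stay within `ε` and `γ`
(`stageAccurate`, `lower_factor`, `upper_factor`, `failure_le`).

For the cost, sample size times number of indices is `O(f₅ f₆)` at every later stage, since the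
factors `t / m` and `m / t` cancel; only the first stage can be larger, when `n₁` exceeds its least
value. -/

noncomputable section

/-! ## Independent samples and tail bounds -/

namespace PMF

variable {α β : Type*}

/-- The law of `n` independent samples of `p`. -/
def iid (p : PMF α) : ℕ → PMF (List α)
  | 0 => pure []
  | n + 1 => p.bind fun a => (iid p n).bind fun as => pure (a :: as)

theorem of_mem_support_iid {p : PMF α} {n : ℕ} {l : List α} (h : l ∈ (p.iid n).support) :
    l.length = n ∧ ∀ a ∈ l, a ∈ p.support := by
  induction n generalizing l with
  | zero => simp [iid] at h; simp [h]
  | succ n ih =>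
    simp only [iid, mem_support_bind_iff, mem_support_pure_iff] at h
    obtain ⟨a, ha, as, has, rfl⟩ := h
    obtain ⟨h1, h2⟩ := ih has
    refine ⟨by simp [h1], ?_⟩
    rintro b (_ | ⟨_, hb⟩)
    · exact ha
    · exact h2 _ ‹_›

/-- The union bound behind all the failure accounting: a bad first draw costs `a`, and after a good
one the rest fails with probability at most `b`. The restriction to the support keeps facts such as
the length of a sample available. -/
theorem toOuterMeasure_bind_le {p : PMF α} {f : α → PMF β} {B : Set α} {S : Set β} {a b : ℝ≥0∞}
    (hB : p.toOuterMeasure B ≤ a)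
    (hf : ∀ x ∈ p.support, x ∉ B → (f x).toOuterMeasure S ≤ b) :
    (p.bind f).toOuterMeasure S ≤ a + b := by
  classical
  rw [toOuterMeasure_bind_apply]
  have h1 : ∀ x, p x * (f x).toOuterMeasure S ≤ B.indicator p x + p x * b := by
    intro x
    by_cases hx : x ∈ B
    · rw [Set.indicator_of_mem hx]
      refine le_trans ?_ le_self_add
      refine (mul_le_mul_right (b := (f x).toOuterMeasure S) (c := 1) ?_ (p x)).trans (by simp)
      calc (f x).toOuterMeasure S ≤ (f x).toOuterMeasure Set.univ := MeasureTheory.measure_mono (Set.subset_univ _)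
        _ = 1 := (toOuterMeasure_apply_eq_one_iff _ _).2 (Set.subset_univ _)
    · rw [Set.indicator_of_notMem hx, zero_add]
      by_cases hs : x ∈ p.support
      · gcongr; exact hf x hs hx
      · rw [(p.apply_eq_zero_iff x).2 hs]; simp
  calc _ ≤ ∑' x, (B.indicator p x + p x * b) := ENNReal.tsum_le_tsum h1
    _ = p.toOuterMeasure B + b := by
      rw [ENNReal.tsum_add, ENNReal.tsum_mul_right, tsum_coe, one_mul, toOuterMeasure_apply]
    _ ≤ _ := by gcongr

theorem toOuterMeasure_le_tsum {p : PMF α} (g : α → ℝ≥0∞) {S : Set α}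
    (h : ∀ x ∈ S, 1 ≤ g x) : p.toOuterMeasure S ≤ ∑' x, p x * g x := by
  rw [toOuterMeasure_apply]
  refine ENNReal.tsum_le_tsum fun x => ?_
  by_cases hx : x ∈ S
  · rw [Set.indicator_of_mem hx]
    exact le_mul_of_one_le_right (by simp) (h x hx)
  · simp [hx]

theorem tsum_bind_mul (p : PMF α) (f : α → PMF β) (g : β → ℝ≥0∞) :
    ∑' b, (p.bind f) b * g b = ∑' a, p a * ∑' b, f a b * g b := by
  simp only [bind_apply, ← ENNReal.tsum_mul_right, ← ENNReal.tsum_mul_left]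
  rw [ENNReal.tsum_comm]
  simp only [mul_assoc]

theorem tsum_pure_mul (b : β) (g : β → ℝ≥0∞) : ∑' x, (pure b) x * g x = g b := by
  rw [tsum_eq_single b]
  · simp
  · intro x hx; simp [hx]

theorem tsum_map_mul (p : PMF α) (f : α → β) (g : β → ℝ≥0∞) :
    ∑' b, (p.map f) b * g b = ∑' a, p a * g (f a) := by
  rw [← bind_pure_comp, tsum_bind_mul]
  simp

theorem tsum_iid_prod (p : PMF α) (g : α → ℝ≥0∞) (n : ℕ) :
    ∑' l, p.iid n l * (l.map g).prod = (∑' a, p a * g a) ^ n := by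
  induction n with
  | zero => simp [iid]
  | succ n ih =>
    simp only [iid, tsum_bind_mul, tsum_pure_mul, List.map_cons, List.prod_cons]
    simp_rw [mul_left_comm _ (g _), ENNReal.tsum_mul_left, ih]
    simp_rw [← mul_assoc, ENNReal.tsum_mul_right]
    rw [pow_succ']

theorem ofReal_exp_list_sum (f : α → ℝ) (c d : ℝ) (l : List α) :
    ENNReal.ofReal (Real.exp (d * (l.map f).sum - c)) =
      (l.map fun a => ENNReal.ofReal (Real.exp (d * f a))).prod *
        ENNReal.ofReal (Real.exp (-c)) := by
  induction l with
  | nil => simp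
  | cons a l ih =>
    simp only [List.map_cons, List.sum_cons, List.prod_cons]
    rw [mul_assoc, ← ih, ← ENNReal.ofReal_mul (Real.exp_pos _).le, ← Real.exp_add]
    congr 2; ring

/-- Markov's inequality for the exponential moment of a sum of independent samples. -/
theorem toOuterMeasure_iid_le_exp {p : PMF α} {f : α → ℝ} {n : ℕ} {c d y : ℝ} {S : Set (List α)}
    (hy : ∑' a, p a * ENNReal.ofReal (Real.exp (d * f a)) ≤ ENNReal.ofReal (Real.exp y))
    (hS : ∀ l ∈ S, c ≤ d * (l.map f).sum) :
    (p.iid n).toOuterMeasure S ≤ ENNReal.ofReal (Real.exp (n * y - c)) := by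
  refine (toOuterMeasure_le_tsum
    (fun l => ENNReal.ofReal (Real.exp (d * (l.map f).sum - c))) fun l hl => ?_).trans ?_
  · rw [ENNReal.one_le_ofReal, Real.one_le_exp_iff]
    linarith [hS l hl]
  · simp_rw [ofReal_exp_list_sum, ← mul_assoc]
    rw [ENNReal.tsum_mul_right, tsum_iid_prod, sub_eq_add_neg, Real.exp_add,
      ENNReal.ofReal_mul (Real.exp_pos _).le, Real.exp_nat_mul, ENNReal.ofReal_pow (Real.exp_pos _).le]
    gcongr

/-- By convexity, the exponential lies below its chord on `[0, 1]`. -/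
theorem exp_mul_le_one_add {x : ℝ} (hx : x ∈ Set.Icc (0 : ℝ) 1) (d : ℝ) :
    Real.exp (d * x) ≤ 1 + (Real.exp d - 1) * x := by
  have := convexOn_exp.2 (Set.mem_univ 0) (Set.mem_univ d) (sub_nonneg.2 hx.2) hx.1 (by ring)
  simp only [smul_eq_mul, mul_zero, zero_add, Real.exp_zero, mul_one] at this
  rw [mul_comm]
  linarith

/-- The upper tail of Chernoff's bound for samples of a variable with values in `[0, 1]`. -/
theorem iid_upper_tail {p : PMF α} {f : α → ℝ} (hf : ∀ a ∈ p.support, f a ∈ Set.Icc (0 : ℝ) 1)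
    {μ B ε : ℝ} {n : ℕ} (hμ : ∑' a, p a * ENNReal.ofReal (f a) ≤ ENNReal.ofReal μ) (hμ0 : 0 ≤ μ)
    (hB : n * μ ≤ B) (hε : ε ∈ Set.Ioc (0 : ℝ) 1) :
    (p.iid n).toOuterMeasure {l | (1 + ε) * B ≤ (l.map f).sum} ≤
      ENNReal.ofReal (Real.exp (-(ε ^ 2 * B / 4))) := by
  have hd : 0 ≤ Real.exp (ε / 2) - 1 := by
    linarith [Real.add_one_le_exp (ε / 2), hε.1]
  -- With `d = ε / 2` and `exp d ≤ 1 + d + d ^ 2`, the exponent is at most `(d + d ^ 2) B - d (1 +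
  -- ε) B = -ε ^ 2 B / 4`.
  refine (toOuterMeasure_iid_le_exp (f := f) (d := ε / 2) (c := ε / 2 * ((1 + ε) * B))
    (y := (Real.exp (ε / 2) - 1) * μ) ?_ fun l hl => ?_).trans ?_
  · calc ∑' a, p a * ENNReal.ofReal (Real.exp (ε / 2 * f a))
        ≤ ∑' a, (p a + ENNReal.ofReal (Real.exp (ε / 2) - 1) *
            (p a * ENNReal.ofReal (f a))) := by
          refine ENNReal.tsum_le_tsum fun a => ?_
          by_cases ha : a ∈ p.support
          · calc _ ≤ p a * ENNReal.ofReal (1 + (Real.exp (ε / 2) - 1) * f a) := by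
                  gcongr; exact exp_mul_le_one_add (hf a ha) _
              _ = _ := by
                rw [ENNReal.ofReal_add zero_le_one (mul_nonneg hd (hf a ha).1),
                  ENNReal.ofReal_mul hd, ENNReal.ofReal_one]
                ring
          · simp [(p.apply_eq_zero_iff a).2 ha]
      _ = 1 + ENNReal.ofReal (Real.exp (ε / 2) - 1) * ∑' a, p a * ENNReal.ofReal (f a) := by
        rw [ENNReal.tsum_add, tsum_coe, ENNReal.tsum_mul_left]
      _ ≤ 1 + ENNReal.ofReal (Real.exp (ε / 2) - 1) * ENNReal.ofReal μ := by gcongr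
      _ = ENNReal.ofReal (1 + (Real.exp (ε / 2) - 1) * μ) := by
        rw [ENNReal.ofReal_add zero_le_one (mul_nonneg hd hμ0), ENNReal.ofReal_mul hd,
          ENNReal.ofReal_one]
      _ ≤ _ := ENNReal.ofReal_le_ofReal (by
        linarith [Real.add_one_le_exp ((Real.exp (ε / 2) - 1) * μ)])
  · exact mul_le_mul_of_nonneg_left hl (by linarith [hε.1])
  · refine ENNReal.ofReal_le_ofReal (Real.exp_le_exp.2 ?_)
    have h1 := (abs_le.1 (Real.abs_exp_sub_one_sub_id_le (x := ε / 2)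
      (by rw [abs_of_pos (by linarith [hε.1])]; linarith [hε.2]))).2
    have hB0 : 0 ≤ B := le_trans (by positivity) hB
    have h2 : (n : ℝ) * ((Real.exp (ε / 2) - 1) * μ) ≤ (Real.exp (ε / 2) - 1) * B := by
      nlinarith
    nlinarith

/-- The lower tail of Chernoff's bound for samples of a variable with values in `[0, 1]`. -/
theorem iid_lower_tail {p : PMF α} {f : α → ℝ} (hf : ∀ a ∈ p.support, f a ∈ Set.Icc (0 : ℝ) 1)
    {μ B ε : ℝ} {n : ℕ} (hμ : ENNReal.ofReal μ ≤ ∑' a, p a * ENNReal.ofReal (f a)) (hμ0 : 0 ≤ μ)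
    (hB : B ≤ n * μ) (hB0 : 0 ≤ B) (hε : ε ∈ Set.Ioc (0 : ℝ) 1) :
    (p.iid n).toOuterMeasure {l | (l.map f).sum ≤ (1 - ε) * B} ≤
      ENNReal.ofReal (Real.exp (-(ε ^ 2 * B / 4))) := by
  have hd : 0 ≤ 1 - Real.exp (-(ε / 2)) := by
    have : Real.exp (-(ε / 2)) ≤ 1 := Real.exp_le_one_iff.2 (by linarith [hε.1])
    linarith
  refine (toOuterMeasure_iid_le_exp (f := f) (d := -(ε / 2)) (c := -(ε / 2) * ((1 - ε) * B))
    (y := -((1 - Real.exp (-(ε / 2))) * μ)) ?_ fun l hl => ?_).trans ?_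
  -- The moment bound is first stated additively, because subtraction in `ℝ≥0∞` truncates.
  · have key : ∑' a, p a * ENNReal.ofReal (Real.exp (-(ε / 2) * f a)) +
        ENNReal.ofReal ((1 - Real.exp (-(ε / 2))) * μ) ≤ 1 := by
      calc _ ≤ ∑' a, p a * ENNReal.ofReal (Real.exp (-(ε / 2) * f a)) +
            ENNReal.ofReal (1 - Real.exp (-(ε / 2))) * ∑' a, p a * ENNReal.ofReal (f a) := by
              rw [ENNReal.ofReal_mul hd]; gcongr
        _ = ∑' a, (p a * ENNReal.ofReal (Real.exp (-(ε / 2) * f a)) +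
            ENNReal.ofReal (1 - Real.exp (-(ε / 2))) * (p a * ENNReal.ofReal (f a))) := by
              rw [ENNReal.tsum_add, ENNReal.tsum_mul_left]
        _ ≤ ∑' a, p a := by
          refine ENNReal.tsum_le_tsum fun a => ?_
          by_cases ha : a ∈ p.support
          · calc _ = p a * ENNReal.ofReal (Real.exp (-(ε / 2) * f a) +
                    (1 - Real.exp (-(ε / 2))) * f a) := by
                  rw [ENNReal.ofReal_add (Real.exp_pos _).le (mul_nonneg hd (hf a ha).1),
                    ENNReal.ofReal_mul hd]
                  ring
              _ ≤ p a * ENNReal.ofReal 1 := by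
                  gcongr; linarith [exp_mul_le_one_add (hf a ha) (-(ε / 2))]
              _ = _ := by simp
          · simp [(p.apply_eq_zero_iff a).2 ha]
        _ = 1 := tsum_coe p
    calc _ ≤ 1 - ENNReal.ofReal ((1 - Real.exp (-(ε / 2))) * μ) :=
          ENNReal.le_sub_of_add_le_right ENNReal.ofReal_ne_top key
      _ = ENNReal.ofReal (1 - (1 - Real.exp (-(ε / 2))) * μ) := by
          rw [ENNReal.ofReal_sub _ (mul_nonneg hd hμ0), ENNReal.ofReal_one]
      _ ≤ _ := ENNReal.ofReal_le_ofReal (by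
        linarith [Real.add_one_le_exp (-((1 - Real.exp (-(ε / 2))) * μ))])
  · exact mul_le_mul_of_nonpos_left hl (by linarith [hε.1])
  · refine ENNReal.ofReal_le_ofReal (Real.exp_le_exp.2 ?_)
    have h1 := (abs_le.1 (Real.abs_exp_sub_one_sub_id_le (x := -(ε / 2))
      (by rw [abs_neg, abs_of_pos (by linarith [hε.1])]; linarith [hε.2]))).2
    have h2 : (1 - Real.exp (-(ε / 2))) * B ≤ (n : ℝ) * ((1 - Real.exp (-(ε / 2))) * μ) := by
      nlinarith
    nlinarith

/-- Chernoff's bound for samples of a variable with values in `[0, 1]`. -/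
theorem iid_two_sided_tail {p : PMF α} {f : α → ℝ}
    (hf : ∀ a ∈ p.support, f a ∈ Set.Icc (0 : ℝ) 1)
    {μ B ε : ℝ} {n : ℕ} (hμ : ∑' a, p a * ENNReal.ofReal (f a) = ENNReal.ofReal μ) (hμ0 : 0 ≤ μ)
    (hB : B ≤ n * μ) (hε : ε ∈ Set.Ioc (0 : ℝ) 1) :
    (p.iid n).toOuterMeasure
        {l | ¬ ((1 - ε) * (n * μ) ≤ (l.map f).sum ∧ (l.map f).sum ≤ (1 + ε) * (n * μ))} ≤
      ENNReal.ofReal (2 * Real.exp (-(ε ^ 2 * B / 4))) := by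
  have h1 := iid_upper_tail hf hμ.le hμ0 (n := n) le_rfl hε
  have h2 := iid_lower_tail hf hμ.ge hμ0 (n := n) le_rfl (by positivity) hε
  have h3 : ENNReal.ofReal (Real.exp (-(ε ^ 2 * (n * μ) / 4))) ≤
      ENNReal.ofReal (Real.exp (-(ε ^ 2 * B / 4))) := by gcongr
  rw [two_mul, ENNReal.ofReal_add (Real.exp_pos _).le (Real.exp_pos _).le]
  refine (MeasureTheory.measure_mono ?_).trans ((MeasureTheory.measure_union_le
    {l : List α | (1 + ε) * (n * μ) ≤ (l.map f).sum}
    {l : List α | (l.map f).sum ≤ (1 - ε) * (n * μ)}).trans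
    (add_le_add (h1.trans h3) (h2.trans h3)))
  intro l hl
  simp only [Set.mem_ofPred_eq, not_and_or, not_le, Set.mem_union] at hl ⊢
  rcases hl with h | h
  · exact Or.inr h.le
  · exact Or.inl h.le

theorem tsum_uniformOfFintype_mul [Fintype α] [Nonempty α] (f : α → ℝ) (hf : ∀ a, 0 ≤ f a) :
    ∑' a, uniformOfFintype α a * ENNReal.ofReal (f a) =
      ENNReal.ofReal ((∑ a, f a) / Fintype.card α) := by
  have hc : (0 : ℝ) < Fintype.card α := by exact_mod_cast Fintype.card_pos
  rw [tsum_fintype]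
  simp only [uniformOfFintype_apply]
  rw [← Finset.mul_sum, ← ENNReal.ofReal_sum_of_nonneg fun a _ => hf a,
    ENNReal.ofReal_div_of_pos hc, ENNReal.ofReal_natCast, mul_comm, div_eq_mul_inv]

end PMF

/-! ## The law of the value and the cost of a program -/

namespace Prog

variable {m : ℕ} [NeZero m] {X α β : Type*} {αL αR βL βR : ℝ} (L : ApproxList m X αL αR βL βR)

/-- The law of the value returned by a program. -/
def law (p : Prog m X α) : PMF α := (p.run L).map Outcome.value

theorem law_aux (p : PMF (Outcome α)) (t r : ℕ) :
    (p.map (Outcome.add t r)).map Outcome.value = p.map Outcome.value := PMF.map_comp _ _ _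

@[simp] theorem law_ret (a : α) : (ret a : Prog m X α).law L = PMF.pure a := by
  simp [law, run, PMF.pure_map]

@[simp] theorem law_work (k : ℕ) (p : Prog m X α) : (work k p).law L = p.law L := law_aux _ _ _

@[simp] theorem law_pickSet (p : Fin m → Prog m X α) :
    (pickSet p).law L = L.pick.bind fun i => (p i).law L := by
  simp only [law, run, PMF.map_bind, law_aux]

@[simp] theorem law_uniform (n : ℕ) [NeZero n] (p : Fin n → Prog m X α) :
    (uniform n p).law L = (PMF.uniformOfFintype (Fin n)).bind fun j => (p j).law L := by
  simp only [law, run, PMF.map_bind, law_aux]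

@[simp] theorem law_round (g : List (Fin m)) (q : List (X × List (Fin m)))
    (p : List X → List (List Bool) → Prog m X α) :
    (round g q p).law L = (L.genBatch g).bind fun xs => (p xs (L.answers q)).law L := by
  simp only [law, run, PMF.map_bind, law_aux]

@[simp] theorem law_bind (p : Prog m X α) (f : α → Prog m X β) :
    (p.bind f).law L = (p.law L).bind fun a => (f a).law L := by
  induction p with
  | ret a => simp [bind]
  | work k p ih => simp [bind, ih]
  | pickSet p ih => simp [bind, ih]
  | uniform n p ih => simp [bind, ih]
  | round g q p ih => simp [bind, ih]

theorem law_times (p : Prog m X α) (n : ℕ) : (times p n).law L = (p.law L).iid n := by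
  induction n with
  | zero => simp [times, PMF.iid]
  | succ n ih => simp [times, PMF.iid, ih]

/-- Every run of `p` returns a value that satisfies `Q`, in time at most `t` and with at most `r`
rounds. -/
def Bounded (p : Prog m X α) (Q : α → Prop) (t r : ℝ) : Prop :=
  ∀ o ∈ (p.run L).support, Q o.value ∧ (o.time : ℝ) ≤ t ∧ (o.rounds : ℝ) ≤ r

variable {L}

theorem Bounded.mono {p : Prog m X α} {Q Q' : α → Prop} {t t' r r' : ℝ} (h : Bounded L p Q t r)
    (hQ : ∀ a, Q a → Q' a) (ht : t ≤ t') (hr : r ≤ r') : Bounded L p Q' t' r' := fun o ho =>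
  ⟨hQ _ (h o ho).1, (h o ho).2.1.trans ht, (h o ho).2.2.trans hr⟩

theorem bounded_ret {a : α} {Q : α → Prop} (h : Q a) : Bounded L (ret a) Q 0 0 := by
  intro o ho
  simp only [run, PMF.mem_support_pure_iff] at ho
  simp [ho, h]

theorem Bounded.add {p : PMF (Outcome α)} {Q : α → Prop} {t r : ℝ}
    (h : ∀ o ∈ p.support, Q o.value ∧ (o.time : ℝ) ≤ t ∧ (o.rounds : ℝ) ≤ r) (k l : ℕ) :
    ∀ o ∈ (p.map (Outcome.add k l)).support,
      Q o.value ∧ (o.time : ℝ) ≤ k + t ∧ (o.rounds : ℝ) ≤ l + r := by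
  intro o ho
  rw [PMF.mem_support_map_iff] at ho
  obtain ⟨o, ho, rfl⟩ := ho
  obtain ⟨h1, h2, h3⟩ := h o ho
  refine ⟨h1, ?_, ?_⟩ <;> simp only [Outcome.add] <;> push_cast <;> linarith

theorem Bounded.work {p : Prog m X α} {Q : α → Prop} {t r : ℝ} (h : Bounded L p Q t r) (k : ℕ) :
    Bounded L (work k p) Q (k + t) r := by
  intro o ho
  simpa using Bounded.add h k 0 o ho

theorem Bounded.pickSet {p : Fin m → Prog m X α} {Q : α → Prop} {t r : ℝ}
    (h : ∀ i, Bounded L (p i) Q t r) : Bounded L (pickSet p) Q (1 + t) r := by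
  intro o ho
  simp only [run, PMF.mem_support_bind_iff] at ho
  obtain ⟨i, _, ho⟩ := ho
  simpa using Bounded.add (h i) 1 0 o ho

theorem Bounded.uniform {n : ℕ} [NeZero n] {p : Fin n → Prog m X α} {Q : α → Prop} {t r : ℝ}
    (h : ∀ i, Bounded L (p i) Q t r) : Bounded L (uniform n p) Q (1 + t) r := by
  intro o ho
  simp only [run, PMF.mem_support_bind_iff] at ho
  obtain ⟨i, _, ho⟩ := ho
  simpa using Bounded.add (h i) 1 0 o ho

theorem Bounded.round {g : List (Fin m)} {q : List (X × List (Fin m))}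
    {p : List X → List (List Bool) → Prog m X α} {Q : α → Prop} {t r : ℝ}
    (h : ∀ xs ∈ (L.genBatch g).support, Bounded L (p xs (L.answers q)) Q t r) :
    Bounded L (round g q p) Q ((g.length + (q.map fun r => r.2.length).sum : ℕ) + t) (1 + r) := by
  intro o ho
  simp only [run, PMF.mem_support_bind_iff] at ho
  obtain ⟨i, hi, ho⟩ := ho
  simpa only [Nat.cast_one] using Bounded.add (h i hi) _ 1 o ho

/-- Every outcome of a composition splits into an outcome of `p` and one of the continuation at its
value, with times and rounds added. -/
theorem Bounded.bind {p : Prog m X α} {f : α → Prog m X β} {Q : α → Prop} {Q' : β → Prop}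
    {t t' r r' : ℝ} (h : Bounded L p Q t r) (h' : ∀ a, Q a → Bounded L (f a) Q' t' r') :
    Bounded L (p.bind f) Q' (t + t') (r + r') := by
  have key : ∀ (p : Prog m X α), ∀ o ∈ ((p.bind f).run L).support, ∃ o₁ ∈ (p.run L).support,
      ∃ o₂ ∈ ((f o₁.value).run L).support, o = o₂.add o₁.time o₁.rounds := by
    clear h p
    intro p
    induction p with
    | ret a =>
      intro o ho
      refine ⟨⟨a, 0, 0⟩, by simp [run], o, ho, by simp [Outcome.add]⟩
    | work k p ih =>
      intro o ho
      simp only [Prog.bind, run, PMF.mem_support_map_iff] at ho ⊢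
      obtain ⟨o, ho, rfl⟩ := ho
      obtain ⟨o₁, h₁, o₂, h₂, rfl⟩ := ih o ho
      exact ⟨_, ⟨o₁, h₁, rfl⟩, o₂, h₂, by simp [Outcome.add, add_assoc]⟩
    | pickSet p ih =>
      intro o ho
      simp only [Prog.bind, run, PMF.mem_support_map_iff, PMF.mem_support_bind_iff] at ho ⊢
      obtain ⟨i, hi, o, ho, rfl⟩ := ho
      obtain ⟨o₁, h₁, o₂, h₂, rfl⟩ := ih i o ho
      exact ⟨_, ⟨i, hi, o₁, h₁, rfl⟩, o₂, h₂, by simp [Outcome.add, add_assoc]⟩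
    | uniform n p ih =>
      intro o ho
      simp only [Prog.bind, run, PMF.mem_support_map_iff, PMF.mem_support_bind_iff] at ho ⊢
      obtain ⟨i, hi, o, ho, rfl⟩ := ho
      obtain ⟨o₁, h₁, o₂, h₂, rfl⟩ := ih i o ho
      exact ⟨_, ⟨i, hi, o₁, h₁, rfl⟩, o₂, h₂, by simp [Outcome.add, add_assoc]⟩
    | round g q p ih =>
      intro o ho
      simp only [Prog.bind, run, PMF.mem_support_map_iff, PMF.mem_support_bind_iff] at ho ⊢
      obtain ⟨i, hi, o, ho, rfl⟩ := ho
      obtain ⟨o₁, h₁, o₂, h₂, rfl⟩ := ih _ _ o ho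
      exact ⟨_, ⟨i, hi, o₁, h₁, rfl⟩, o₂, h₂, by simp [Outcome.add, add_assoc]⟩
  intro o ho
  obtain ⟨o₁, h₁, o₂, h₂, rfl⟩ := key p o ho
  obtain ⟨a1, a2, a3⟩ := h o₁ h₁
  obtain ⟨b1, b2, b3⟩ := h' _ a1 o₂ h₂
  refine ⟨b1, ?_, ?_⟩ <;> simp only [Outcome.add] <;> push_cast <;> linarith

theorem Bounded.times {p : Prog m X α} {Q : α → Prop} {t : ℝ} (h : Bounded L p Q t 0) (n : ℕ) :
    Bounded L (times p n) (fun l => l.length = n ∧ ∀ a ∈ l, Q a) (n * (1 + t)) 0 := by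
  induction n with
  | zero => exact (bounded_ret (by simp)).mono (fun _ h => h) (by simp) le_rfl
  | succ n ih =>
    refine ((h.bind (Q' := fun l => l.length = n + 1 ∧ ∀ a ∈ l, Q a) fun a ha => ih.bind
      fun as has => bounded_ret (?_ : (a :: as).length = n + 1 ∧ ∀ b ∈ a :: as, Q b)).work
      1).mono (fun _ h => h) ?_ (by simp)
    · simp [has.1, ha]; exact has.2
    · push_cast; linarith

theorem bounded_resample {R : List X} (hR : R ≠ []) (n : ℕ) :
    Bounded L (resample R n) (fun l => l.length = n ∧ ∀ a ∈ l, a ∈ R) (n * 2) 0 := by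
  cases R with
  | nil => exact absurd rfl hR
  | cons x xs =>
    refine (Bounded.times (Q := fun a => a ∈ x :: xs) (t := 1) ((Bounded.uniform (t := 0)
      fun i =>
      bounded_ret (Q := fun a => a ∈ x :: xs) (List.get_mem (x :: xs) i)).mono (fun _ h => h) (add_zero 1).le le_rfl) n).mono
      (fun _ h => h) ?_ le_rfl
    norm_num

/-- The law of a uniform random element of a list with multiplicities. -/
theorem law_resample (L : ApproxList m X αL αR βL βR) {R : List X} (hR : R ≠ []) (n : ℕ) :
    haveI : Nonempty (Fin R.length) := ⟨⟨0, List.length_pos_of_ne_nil hR⟩⟩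
    (resample R n).law L = ((PMF.uniformOfFintype (Fin R.length)).map R.get).iid n := by
  cases R with
  | nil => exact absurd rfl hR
  | cons x xs =>
    simp only [resample, law_times, law_uniform, law_ret]
    rfl

end Prog

namespace ApproxList

variable {m : ℕ} {X : Type*} {αL αR βL βR : ℝ} (L : ApproxList m X αL αR βL βR)

/-- A random choice of the list: select a set and an element of it. -/
def choice [NeZero m] : PMF X := L.pick.bind L.gen

/-- The algorithm draws all indices before it sends the requests. By independence the two kinds of
draws can be interleaved, which gives independent random choices. -/
theorem iid_pick_bind_genBatch [NeZero m] (n : ℕ) : (L.pick.iid n).bind L.genBatch = L.choice.iid n := by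
  induction n with
  | zero => simp [PMF.iid, genBatch]
  | succ n ih =>
    simp only [PMF.iid, PMF.bind_bind, PMF.pure_bind, genBatch]
    rw [← ih, choice, PMF.bind_bind]
    congr 1; funext i
    rw [PMF.bind_comm]
    simp only [PMF.bind_bind]

theorem length_of_mem_support_genBatch {g : List (Fin m)} {xs : List X}
    (h : xs ∈ (L.genBatch g).support) : xs.length = g.length := by
  induction g generalizing xs with
  | nil => simp [genBatch] at h; simp [h]
  | cons i g ih =>
    simp only [genBatch, PMF.mem_support_bind_iff, PMF.mem_support_pure_iff] at h
    obtain ⟨x, _, ys, hys, rfl⟩ := h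
    simp [ih hys]

end ApproxList

/-! ## The parameters -/

namespace Params

variable {m : ℕ} (P : Params m)

theorem two_le_cast {m : ℕ} (P : Params m) : (2 : ℝ) ≤ m := by exact_mod_cast P.two_le_m

theorem one_le_logb {m : ℕ} (P : Params m) : 1 ≤ Real.logb 2 m := by
  rw [Real.le_logb_iff_rpow_le (by norm_num) (by linarith [P.two_le_cast])]
  simpa using P.two_le_cast

theorem one_le_zmin_cast : (1 : ℝ) ≤ P.zmin := by exact_mod_cast P.one_le_zmin
theorem zmin_le_zmax_cast : (P.zmin : ℝ) ≤ P.zmax := by exact_mod_cast P.zmin_le_zmax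
theorem zmax_le_cast : (P.zmax : ℝ) ≤ m := by exact_mod_cast P.zmax_le

theorem ε₁_pos : 0 < P.ε₁ := by
  have := P.one_le_logb; have := P.ε_mem.1
  unfold ε₁ ε₀; positivity

theorem ε₁_mul_logb : P.ε₁ * Real.logb 2 m = P.ε / 54 := by
  have := P.one_le_logb
  unfold ε₁ ε₀; field_simp; ring

theorem ε₁_lt : P.ε₁ < 1 / 54 := by
  nlinarith [P.one_le_logb, P.ε_mem.2, P.ε₁_mul_logb, P.ε₁_pos]

theorem ε₂_pos : 0 < P.ε₂ := by have := P.ε₁_pos; unfold ε₂; positivity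

theorem ε₂_lt : P.ε₂ < 1 / 216 := by have := P.ε₁_lt; unfold ε₂; linarith

theorem δ_pos : 0 < P.δ := by have := P.ε₂_pos; unfold δ; positivity

theorem γ₂_pos : 0 < P.γ₂ := by
  have := P.one_le_logb; have := P.γ_mem.1
  unfold γ₂; positivity

theorem γ₂_mul_logb : P.γ₂ * Real.logb 2 m = P.γ / 6 := by
  have := P.one_le_logb
  unfold γ₂; field_simp

theorem γ₂_lt : P.γ₂ < 1 / 6 := by
  nlinarith [P.one_le_logb, P.γ_mem.2, P.γ₂_mul_logb, P.γ₂_pos]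

theorem f₂_nonneg : 0 ≤ P.f₂ := by
  have h1 : 0 ≤ Real.logb 2 ((m : ℝ) / P.zmin) := by
    refine Real.logb_nonneg (by norm_num) ?_
    rw [one_le_div (by linarith [P.one_le_zmin_cast])]
    linarith [P.zmin_le_zmax_cast, P.zmax_le_cast]
  have h2 : 0 ≤ Real.logb 2 (1 + P.δ) :=
    Real.logb_nonneg (by norm_num) (by linarith [P.δ_pos])
  have h3 : 0 < P.ε₃ := by have := P.ε_mem.1; unfold ε₃ ε₀; positivity
  unfold f₂; positivity

theorem one_le_log_two_div {g : ℝ} (hg : 0 < g) (hg' : g ≤ 1 / 2) : 1 ≤ Real.log (2 / g) := by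
  rw [Real.le_log_iff_exp_le (by positivity), le_div_iff₀ hg]
  nlinarith [Real.exp_one_lt_d9]

theorem le_f₄ : 6 * Real.log (2 / P.γ₂) / P.ε₂ ^ 3 ≤ P.f₄ := by
  have h1 : 0 ≤ Real.logb 2 ((m : ℝ) ^ 2 / P.ε₁) := by
    refine Real.logb_nonneg (by norm_num) ?_
    rw [one_le_div P.ε₁_pos]
    nlinarith [P.two_le_cast, P.ε₁_lt]
  have h2 := P.f₂_nonneg
  have h3 := P.ε₂_pos
  have h4 := P.eight_le_f₁
  have : P.f₃ / (P.ε₂ * P.f₁) = 6 * Real.log (2 / P.γ₂) / P.ε₂ ^ 3 := by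
    unfold f₃; field_simp
  rw [f₄, this]
  exact le_add_of_nonneg_left (by positivity)

/-- The cube of `ε₂` in the denominator of `f₄` leaves a spare factor `1 / ε₂`, so Chernoff's
exponent exceeds `log (2 / γ₂)`. -/
theorem le_ε₂_sq_mul_f₄ : Real.log (2 / P.γ₂) ≤ P.ε₂ ^ 2 * P.f₄ / 4 := by
  have h1 := P.le_f₄
  have h2 := P.ε₂_pos
  have h3 := P.ε₂_lt
  have h4 := one_le_log_two_div P.γ₂_pos (by linarith [P.γ₂_lt])
  rw [div_le_iff₀ (by positivity)] at h1
  have : P.ε₂ ^ 2 * P.f₄ * P.ε₂ ≤ P.ε₂ ^ 2 * P.f₄ * 1 := by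
    have : 0 ≤ P.f₄ := by
      by_contra h
      have := mul_neg_of_neg_of_pos (not_le.1 h) (by positivity : 0 < P.ε₂ ^ 3)
      linarith
    gcongr; linarith
  linarith

theorem one_le_f₄ : 1 ≤ P.f₄ := by
  have h1 := P.le_ε₂_sq_mul_f₄
  have h2 := P.ε₂_pos
  have h3 := P.ε₂_lt
  have h4 := one_le_log_two_div P.γ₂_pos (by linarith [P.γ₂_lt])
  by_contra h
  have : P.ε₂ ^ 2 * P.f₄ ≤ P.ε₂ ^ 2 * 1 := by gcongr; linarith
  nlinarith

theorem two_mul_exp_neg_le {y g : ℝ} (hg : 0 < g) (h : Real.log (2 / g) ≤ y) :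
    2 * Real.exp (-y) ≤ g := by
  have : Real.exp (-y) ≤ Real.exp (-Real.log (2 / g)) := Real.exp_le_exp.2 (by linarith)
  rw [Real.exp_neg (Real.log _), Real.exp_log (by positivity), inv_div] at this
  linarith

theorem exp_f₄_le : 2 * Real.exp (-(P.ε₂ ^ 2 * P.f₄ / 4)) ≤ P.γ₂ :=
  two_mul_exp_neg_le P.γ₂_pos P.le_ε₂_sq_mul_f₄

theorem f₄_le_f₅ : P.f₄ ≤ P.f₅ := by
  have := P.one_le_f₄; have := P.one_le_zmin_cast
  rw [f₅, le_div_iff₀ (by linarith)]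
  nlinarith [P.zmin_le_zmax_cast, P.zmax_le_cast]

theorem one_le_f₅ : 1 ≤ P.f₅ := P.one_le_f₄.trans P.f₄_le_f₅

theorem f₅_mul_zmin : P.f₅ * P.zmin = m * P.f₄ := by
  have := P.one_le_zmin_cast
  unfold f₅; field_simp

theorem f₅_le_h₁ : P.f₅ ≤ P.h₁ := Nat.le_ceil _

theorem h₁_le : (P.h₁ : ℝ) ≤ 2 * P.f₅ := by
  have := P.one_le_f₅
  have := (Nat.ceil_lt_add_one (by linarith : 0 ≤ P.f₅)).le
  unfold h₁; linarith

theorem γ₃_pos : 0 < P.γ₃ := by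
  have := P.one_le_f₅; have := P.γ₂_pos
  unfold γ₃; positivity

/-- Rounding up at most doubles `f₅`, which the factor 2 in `γ₃` absorbs. This pays for the union
bound over the at most `h₁` elements of a sample. -/
theorem h₁_mul_γ₃_le : P.h₁ * P.γ₃ ≤ P.γ₂ := by
  have h1 := P.one_le_f₅
  have h2 := P.γ₂_pos
  have h3 := P.h₁_le
  unfold γ₃
  rw [mul_div_assoc', div_le_iff₀ (by linarith)]
  nlinarith

theorem γ₃_le : P.γ₃ ≤ 1 / 2 := by
  have h1 := P.h₁_mul_γ₃_le
  have h2 := P.f₅_le_h₁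
  nlinarith [P.one_le_f₅, P.γ₂_lt, P.γ₃_pos]

/-- `f₆ / (4 f₁)` bounds from below the expected score of an element of thickness `t / (4 f₁)`; the
left side is then Chernoff's exponent at accuracy `ε₁`. -/
theorem f₆_eq : P.ε₁ ^ 2 * (P.f₆ / (4 * P.f₁)) / 4 = 3 / 2 * Real.log (2 / P.γ₃) := by
  have := P.ε₁_pos; have := P.eight_le_f₁
  unfold f₆; field_simp; ring

theorem f₆_pos : 0 < P.f₆ := by
  have := one_le_log_two_div P.γ₃_pos P.γ₃_le
  have := P.ε₁_pos; have := P.eight_le_f₁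
  unfold f₆; positivity

theorem one_le_f₆ : 1 ≤ P.f₆ := by
  have h1 := one_le_log_two_div P.γ₃_pos P.γ₃_le
  have h2 := P.ε₁_pos
  have h3 := P.ε₁_lt
  have h5 : 24 ≤ 24 / P.ε₁ ^ 2 := by
    rw [le_div_iff₀ (by positivity)]; nlinarith
  unfold f₆
  nlinarith [P.eight_le_f₁, mul_le_mul h5 h1 zero_le_one (by linarith)]

theorem exp_f₆_le {ε : ℝ} (hε : P.ε₁ ≤ ε) :
    2 * Real.exp (-(ε ^ 2 * (P.f₆ / (4 * P.f₁)) / 4)) ≤ P.γ₃ := by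
  refine two_mul_exp_neg_le P.γ₃_pos ?_
  have h1 := one_le_log_two_div P.γ₃_pos P.γ₃_le
  have h2 := P.f₆_pos; have h3 := P.eight_le_f₁; have h4 := P.ε₁_pos
  have : P.ε₁ ^ 2 * (P.f₆ / (4 * P.f₁)) / 4 ≤ ε ^ 2 * (P.f₆ / (4 * P.f₁)) / 4 := by gcongr
  linarith [P.f₆_eq]

/-- Samples of the size kept at thickness `t` have at least `f₄` expected relevant elements. -/
theorem f₄_le_sampleBound {t : ℝ} (ht : 0 < t) : P.f₄ ≤ P.sampleBound t * (P.zmin / t) := by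
  have hm := P.two_le_cast
  have h1 : (P.h₁ : ℝ) / (m / t) ≤ P.sampleBound t := Nat.le_ceil _
  have hz := P.one_le_zmin_cast
  calc P.f₄ = P.f₅ / (m / t) * (P.zmin / t) := by
        have := P.f₅_mul_zmin
        field_simp; linarith
    _ ≤ P.sampleBound t * (P.zmin / t) := by
        gcongr; exact le_trans (by gcongr; exact P.f₅_le_h₁) h1

theorem sampleBound_pos {t : ℝ} (ht : 0 < t) : 0 < P.sampleBound t := by
  have h1 := P.f₄_le_sampleBound ht
  by_contra h
  have : P.sampleBound t = 0 := by omega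
  rw [this] at h1
  simp at h1
  linarith [P.one_le_f₄]

theorem sampleBound_le {t : ℝ} (ht : 0 < t) (htm : t ≤ m) : P.sampleBound t ≤ P.h₁ := by
  have hm := P.two_le_cast
  refine Nat.ceil_le.2 ?_
  exact div_le_self (by positivity) (by rwa [one_le_div ht])

end Params

/-! ## One stage of the algorithm -/

namespace ApproxList

variable {m : ℕ} {X : Type*} {αL αR βL βR : ℝ} (L : ApproxList m X αL αR βL βR)

open Classical in
/-- The number of indices in `H` (with multiplicity) of sets that contain `x`. -/
def score (H : List (Fin m)) (x : X) : ℕ := (H.map fun i => decide (x ∈ L.set i)).count true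

open Classical in
theorem score_eq (H : List (Fin m)) (x : X) :
    (L.score H x : ℝ) = (H.map fun i => if x ∈ L.set i then (1 : ℝ) else 0).sum := by
  induction H with
  | nil => simp [score]
  | cons i H ih =>
    simp only [score, List.map_cons, List.count_cons, List.sum_cons] at ih ⊢
    push_cast
    rw [ih]
    by_cases h : x ∈ L.set i <;> simp [h, add_comm]

/-- The elements of the sample whose score reaches the threshold. -/
def accepted (thr : ℝ) (H : List (Fin m)) (R : List X) : List X :=
  R.filter fun x => decide (thr ≤ (L.score H x : ℝ))

/-- The elements of the sample whose score does not reach the threshold. -/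
def rejected (thr : ℝ) (H : List (Fin m)) (R : List X) : List X :=
  R.filter fun x => decide ((L.score H x : ℝ) < thr)

/-- The sum of the reciprocal thicknesses of the elements of a sample. -/
def invSum (R : List X) : ℝ := (R.map fun x => 1 / (L.thickness x : ℝ)).sum

theorem invSum_accepted_add_rejected (thr : ℝ) (H : List (Fin m)) (R : List X) :
    L.invSum (L.accepted thr H R) + L.invSum (L.rejected thr H R) = L.invSum R := by
  induction R with
  | nil => simp [invSum, accepted, rejected]
  | cons x R ih =>
    simp only [invSum, accepted, rejected, List.filter_cons] at ih ⊢
    rcases le_or_gt thr (L.score H x : ℝ) with h | h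
    · simp only [h, not_lt.2 h, decide_true, decide_false, if_true, Bool.false_eq_true, if_false,
        List.map_cons, List.sum_cons, ← ih, add_assoc]
    · simp only [h, not_le.2 h, decide_true, decide_false, if_true, Bool.false_eq_true, if_false,
        List.map_cons, List.sum_cons, ← ih, add_left_comm]

theorem invSum_nonneg (R : List X) : 0 ≤ L.invSum R :=
  List.sum_nonneg (by simp only [List.mem_map]; rintro _ ⟨x, _, rfl⟩; positivity)

theorem zip_answers (H : List (Fin m)) (R : List X) :
    R.zip ((L.answers (R.map fun x => (x, H))).map fun row => row.count true) =
      R.map fun x => (x, L.score H x) := by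
  induction R with
  | nil => simp
  | cons x R ih =>
    simp only [answers, List.map_cons, List.zip_cons_cons] at ih ⊢
    rw [ih]
    rfl

end ApproxList

namespace Prog

variable {m : ℕ} [NeZero m] {X : Type*} {αL αR βL βR : ℝ} (L : ApproxList m X αL αR βL βR)

/-- The final part of a stage: shrink the sample and go on. -/
def proceed (P : Params m) (t w sum : ℝ) (rest : List X) : Prog m X ℝ :=
  (if rest.length < P.sampleBound (t / P.f₁) then ret (rest, (1 : ℝ))
    else (resample rest (P.sampleBound (t / P.f₁))).bind fun R' => work 1 <|
      ret (R', (rest.length : ℝ) / P.sampleBound (t / P.f₁))).bind fun Ra =>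
  work 2 <|
  if t / P.f₁ < P.zmin then ret sum
  else stage P Ra.1 (t / P.f₁) (w * Ra.2) sum

/-- The value accumulated at the end of a stage with the random indices `H`. -/
def nextSum (P : Params m) (R : List X) (t w sum : ℝ) (H : List (Fin m)) : ℝ :=
  sum + w * ((L.accepted (t / (2 * P.f₁ * m) * H.length) H R).map
    fun x => (H.length : ℝ) / (L.score H x * m)).sum

/-- Given `H`, the answers to the queries are determined, so the indices are the only randomness
before the sample is shrunk. -/
theorem law_stage (P : Params m) (R : List X) (t w sum : ℝ) :
    (stage P R t w sum).law L =
      ((PMF.uniformOfFintype (Fin m)).iid ⌈(m : ℝ) / t * P.f₆⌉₊).bind fun H =>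
        (proceed P t w (nextSum L P R t w sum H)
          (L.rejected (t / (2 * P.f₁ * m) * H.length) H R)).law L := by
  rw [stage]
  simp only [law_work, law_bind, law_times, law_uniform, law_ret, PMF.bind_pure, law_round,
    ApproxList.genBatch, PMF.pure_bind, L.zip_answers, List.filter_map, List.map_map, Function.comp_def, List.map_id',
    proceed, nextSum, ApproxList.accepted, ApproxList.rejected, dite_eq_ite]
  congr!

end Prog

/-! ## Accuracy of a stage -/

namespace ApproxList

variable {m : ℕ} {X : Type*} {αL αR βL βR : ℝ} (L : ApproxList m X αL αR βL βR)

/-- The score of `x` for the random indices `H` at thickness `t` leads neither to a wrong estimate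
nor to a wrong decision. -/
def GoodScore (P : Params m) (t : ℝ) (H : List (Fin m)) (x : X) : Prop :=
  (t / (4 * P.f₁) ≤ L.thickness x →
    (1 - P.ε₁) * (H.length * (L.thickness x / m)) ≤ L.score H x ∧
      L.score H x ≤ (1 + P.ε₁) * (H.length * (L.thickness x / m))) ∧
  ((L.thickness x : ℝ) < t / (4 * P.f₁) → L.score H x < t / (2 * P.f₁ * m) * H.length)

variable {L} in
-- A score that reaches the threshold rules out thickness below `t / (4 f₁)`, so the two-sided
-- estimate applies.
theorem GoodScore.estimate {P : Params m} {t : ℝ} (ht : 0 < t) {H : List (Fin m)}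
    (hH : 0 < H.length) {x : X} (h : L.GoodScore P t H x)
    (hx : t / (2 * P.f₁ * m) * H.length ≤ L.score H x) :
    1 / (L.thickness x : ℝ) * (1 / (1 + P.ε₁)) ≤ (H.length : ℝ) / (L.score H x * m) ∧
      (H.length : ℝ) / (L.score H x * m) ≤ 1 / (L.thickness x : ℝ) * (1 / (1 - P.ε₁)) := by
  have h8 := P.eight_le_f₁
  have hm := P.two_le_cast
  have he := P.ε₁_pos
  have he' := P.ε₁_lt
  have hu : (0 : ℝ) < H.length := by exact_mod_cast hH
  have hT : t / (4 * P.f₁) ≤ L.thickness x := by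
    by_contra hc
    exact (h.2 (not_le.1 hc)).not_ge hx
  obtain ⟨h1, h2⟩ := h.1 hT
  have hT0 : (0 : ℝ) < L.thickness x := lt_of_lt_of_le (by positivity) hT
  have hS : (0 : ℝ) < L.score H x := lt_of_lt_of_le (by positivity) hx
  have e : H.length * ((L.thickness x : ℝ) / m) * m = H.length * L.thickness x := by field_simp
  rw [one_div_mul_one_div, one_div_mul_one_div]
  constructor
  · rw [div_le_div_iff₀ (by positivity) (by positivity)]
    nlinarith
  · rw [div_le_div_iff₀ (by positivity) (mul_pos hT0 (by linarith))]
    nlinarith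

variable {L} in
-- At thickness `t / f₁` the expected score is twice the threshold, so a score within `1 ± ε₁` of
-- its mean cannot fall below it.
theorem GoodScore.thickness_lt {P : Params m} {t : ℝ} (ht : 0 < t) {H : List (Fin m)}
    (hH : 0 < H.length) {x : X} (h : L.GoodScore P t H x)
    (hx : (L.score H x : ℝ) < t / (2 * P.f₁ * m) * H.length) :
    (L.thickness x : ℝ) < t / P.f₁ := by
  have h8 := P.eight_le_f₁
  have hm := P.two_le_cast
  have he' := P.ε₁_lt
  have hu : (0 : ℝ) < H.length := by exact_mod_cast hH
  by_contra hc
  have hc := not_lt.1 hc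
  have h1 := (h.1 (le_trans (by gcongr; linarith) hc)).1
  have h2 : t / (2 * P.f₁ * m) * H.length = 1 / 2 * (H.length * ((t / P.f₁) / m)) := by
    field_simp
  have h3 : H.length * ((t / P.f₁) / m) ≤ H.length * ((L.thickness x : ℝ) / m) := by gcongr
  have h4 : 0 < H.length * ((t / P.f₁) / m) := by positivity
  nlinarith

open Classical in
theorem tsum_uniform_indicator [NeZero m] (x : X) :
    ∑' i, PMF.uniformOfFintype (Fin m) i * ENNReal.ofReal (if x ∈ L.set i then (1 : ℝ) else 0) =
      ENNReal.ofReal (L.thickness x / m) := by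
  rw [PMF.tsum_uniformOfFintype_mul _ fun i => by split_ifs <;> simp]
  simp [thickness]

open Classical in
theorem badScore_le [NeZero m] (P : Params m) {t : ℝ} (ht : 0 < t) (x : X) :
    ((PMF.uniformOfFintype (Fin m)).iid ⌈(m : ℝ) / t * P.f₆⌉₊).toOuterMeasure
      {H | ¬ L.GoodScore P t H x} ≤ ENNReal.ofReal P.γ₃ := by
  have h8 := P.eight_le_f₁
  have hm := P.two_le_cast
  have h6 := P.f₆_pos
  set u := ⌈(m : ℝ) / t * P.f₆⌉₊ with hu
  have hu' : (m : ℝ) / t * P.f₆ ≤ u := Nat.le_ceil _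
  have hf : ∀ i ∈ (PMF.uniformOfFintype (Fin m)).support,
      (if x ∈ L.set i then (1 : ℝ) else 0) ∈ Set.Icc (0 : ℝ) 1 := by
    intro i _; split_ifs <;> simp
  rcases le_or_gt (t / (4 * P.f₁)) (L.thickness x) with hT | hT
  · have hB : P.f₆ / (4 * P.f₁) ≤ u * (L.thickness x / m) := by
      calc P.f₆ / (4 * P.f₁) = (m : ℝ) / t * P.f₆ * (t / (4 * P.f₁) / m) := by field_simp
        _ ≤ _ := by gcongr
    refine le_trans ?_ (ENNReal.ofReal_le_ofReal (P.exp_f₆_le le_rfl))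
    -- The inclusion is needed only on the support, where `H` has length `u`.
    refine le_trans (PMF.toOuterMeasure_mono _ ?_) (PMF.iid_two_sided_tail hf
      (L.tsum_uniform_indicator x) (by positivity) hB ⟨P.ε₁_pos, by linarith [P.ε₁_lt]⟩)
    rintro H ⟨hH, hs⟩ hc
    rw [← L.score_eq, ← (PMF.of_mem_support_iid hs).1] at hc
    exact hH ⟨fun _ => hc, fun h => absurd hT (not_le.2 h)⟩
  -- For a thin element the mean is replaced by its upper bound `u t / (4 f₁ m)`. The threshold is
  -- exactly twice this bound, so the upper tail with `ε = 1` applies.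
  · have hB : P.f₆ / (4 * P.f₁) ≤ u * (t / (4 * P.f₁) / m) := by
      calc P.f₆ / (4 * P.f₁) = (m : ℝ) / t * P.f₆ * (t / (4 * P.f₁) / m) := by field_simp
        _ ≤ _ := by gcongr
    have hB' : u * ((L.thickness x : ℝ) / m) ≤ u * (t / (4 * P.f₁) / m) := by gcongr
    have h1 := PMF.iid_upper_tail hf (L.tsum_uniform_indicator x).le (by positivity) hB'
      ⟨one_pos, le_rfl⟩
    refine le_trans (le_trans (PMF.toOuterMeasure_mono _ ?_) h1) (ENNReal.ofReal_le_ofReal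
      (le_trans ?_ (P.exp_f₆_le (ε := 1) (by linarith [P.ε₁_lt]))))
    · rintro H ⟨hH, hs⟩
      rw [Set.mem_ofPred_eq, ← L.score_eq, ← (PMF.of_mem_support_iid hs).1]
      by_contra hc
      refine hH ⟨fun h => absurd hT (not_lt.2 h), fun _ => lt_of_lt_of_eq (not_le.1 hc) ?_⟩
      field_simp
      ring
    · refine le_trans (Real.exp_le_exp.2 ?_) (le_mul_of_one_le_left (Real.exp_pos _).le one_le_two)
      linarith

theorem exists_badScore_le [NeZero m] (P : Params m) {t : ℝ} (ht : 0 < t) (R : List X) :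
    ((PMF.uniformOfFintype (Fin m)).iid ⌈(m : ℝ) / t * P.f₆⌉₊).toOuterMeasure
      {H | ∃ x ∈ R, ¬ L.GoodScore P t H x} ≤ ENNReal.ofReal (R.length * P.γ₃) := by
  induction R with
  | nil => simp
  | cons x R ih =>
    have h0 := P.γ₃_pos
    rw [List.length_cons, Nat.cast_succ, add_mul, one_mul, add_comm,
      ENNReal.ofReal_add h0.le (by positivity)]
    refine (MeasureTheory.measure_mono ?_).trans ((MeasureTheory.measure_union_le
      {H | ¬ L.GoodScore P t H x} {H | ∃ x ∈ R, ¬ L.GoodScore P t H x}).trans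
      (add_le_add (L.badScore_le P ht x) ih))
    rintro H ⟨y, hy, hb⟩
    rcases List.mem_cons.1 hy with rfl | hy
    · exact Or.inl hb
    · exact Or.inr ⟨y, hy, hb⟩

/-- The sum of the reciprocal thicknesses of independent samples is concentrated. -/
theorem iid_invSum_tail (P : Params m) {p : PMF X} {t ν : ℝ} {n : ℕ}
    (hp : ∀ x ∈ p.support, (P.zmin : ℝ) ≤ L.thickness x ∧ (L.thickness x : ℝ) ≤ t)
    (hν : ∑' x, p x * ENNReal.ofReal (1 / L.thickness x) = ENNReal.ofReal ν) (hν0 : 0 ≤ ν)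
    (hn : P.f₄ ≤ n * (P.zmin / t)) :
    (p.iid n).toOuterMeasure {R | ¬ ((1 - P.ε₂) * (n * ν) ≤ L.invSum R ∧
      L.invSum R ≤ (1 + P.ε₂) * (n * ν))} ≤ ENNReal.ofReal P.γ₂ := by
  have hz := P.one_le_zmin_cast
  obtain ⟨y, hy⟩ := p.support_nonempty
  have ht : 0 < t := by linarith [(hp y hy).1, (hp y hy).2]
  -- Scaling by `z_min` brings the reciprocal thicknesses into `[0, 1]`, as Chernoff's bound
  -- requires.
  have hf : ∀ x ∈ p.support, (P.zmin : ℝ) * (1 / L.thickness x) ∈ Set.Icc (0 : ℝ) 1 := by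
    intro x hx
    refine ⟨by positivity, ?_⟩
    rw [mul_one_div, div_le_one (by linarith [(hp x hx).1])]
    exact (hp x hx).1
  have hμ : ∑' x, p x * ENNReal.ofReal (P.zmin * (1 / L.thickness x)) =
      ENNReal.ofReal (P.zmin * ν) := by
    rw [ENNReal.ofReal_mul (by positivity), ← hν, ← ENNReal.tsum_mul_left]
    congr 1; funext x
    rw [ENNReal.ofReal_mul (by positivity), mul_left_comm]
  have hν1 : 1 / t ≤ ν := by
    rw [← ENNReal.ofReal_le_ofReal_iff hν0, ← hν]
    calc ENNReal.ofReal (1 / t) = ∑' x, p x * ENNReal.ofReal (1 / t) := by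
          rw [ENNReal.tsum_mul_right, PMF.tsum_coe, one_mul]
      _ ≤ _ := by
        refine ENNReal.tsum_le_tsum fun x => ?_
        by_cases hx : x ∈ p.support
        · have := (hp x hx)
          have h0 : (0 : ℝ) < L.thickness x := by linarith
          gcongr
          exact this.2
        · simp [(p.apply_eq_zero_iff x).2 hx]
  have hB : P.f₄ ≤ n * (P.zmin * ν) := by
    refine hn.trans ?_
    rw [div_eq_mul_one_div]
    gcongr
  refine le_trans (le_trans (MeasureTheory.measure_mono ?_) (PMF.iid_two_sided_tail hf hμ
    (by positivity) hB ⟨P.ε₂_pos, by linarith [P.ε₂_lt]⟩)) (ENNReal.ofReal_le_ofReal P.exp_f₄_le)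
  intro R hR hc
  refine hR ?_
  rw [List.sum_map_mul_left] at hc
  constructor
  · refine le_of_mul_le_mul_left ?_ (by linarith : (0 : ℝ) < P.zmin)
    calc _ = (1 - P.ε₂) * (n * (P.zmin * ν)) := by ring
      _ ≤ _ := hc.1
  · refine le_of_mul_le_mul_left ?_ (by linarith : (0 : ℝ) < P.zmin)
    calc _ ≤ (1 + P.ε₂) * (n * (P.zmin * ν)) := hc.2
      _ = _ := by ring

/-- The factor `R.length / n` is the change of weight `a_i`; it makes the weighted sum over the new
sample unbiased for `invSum R`. -/
theorem resample_invSum_tail (P : Params m) {R : List X} {t : ℝ} {n : ℕ} [Nonempty (Fin R.length)]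
    (hR : ∀ x ∈ R, (P.zmin : ℝ) ≤ L.thickness x ∧ (L.thickness x : ℝ) ≤ t)
    (hn : P.f₄ ≤ n * (P.zmin / t)) :
    (((PMF.uniformOfFintype (Fin R.length)).map R.get).iid n).toOuterMeasure
      {R' | ¬ ((1 - P.ε₂) * L.invSum R ≤ (R.length : ℝ) / n * L.invSum R' ∧
        (R.length : ℝ) / n * L.invSum R' ≤ (1 + P.ε₂) * L.invSum R)} ≤ ENNReal.ofReal P.γ₂ := by
  have hl : (0 : ℝ) < R.length := by
    have := Fin.pos_iff_nonempty.2 ‹Nonempty (Fin R.length)›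
    exact_mod_cast this
  have hn0 : (0 : ℝ) < n := by
    rcases Nat.eq_zero_or_pos n with rfl | h
    · simp at hn; linarith [P.one_le_f₄]
    · exact_mod_cast h
  refine (MeasureTheory.measure_mono ?_).trans
    (L.iid_invSum_tail P (ν := L.invSum R / R.length) ?_ ?_
      (div_nonneg (L.invSum_nonneg R) hl.le) hn)
  · intro R' hR' hc
    refine hR' ?_
    have e : (R.length : ℝ) / n * (n * (L.invSum R / R.length)) = L.invSum R := by field_simp
    constructor
    · calc _ = (R.length : ℝ) / n * ((1 - P.ε₂) * (n * (L.invSum R / R.length))) := by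
            rw [mul_left_comm, e]
        _ ≤ _ := by gcongr; exact hc.1
    · calc _ ≤ (R.length : ℝ) / n * ((1 + P.ε₂) * (n * (L.invSum R / R.length))) := by
            gcongr; exact hc.2
        _ = _ := by rw [mul_left_comm, e]
  · intro x hx
    rw [PMF.mem_support_map_iff] at hx
    obtain ⟨i, _, rfl⟩ := hx
    exact hR _ (List.get_mem _ _)
  · rw [PMF.tsum_map_mul, PMF.tsum_uniformOfFintype_mul (fun i => 1 / (L.thickness (R.get i) : ℝ))
      fun i => by positivity]
    congr 2
    · rw [invSum, ← Fin.sum_univ_fun_getElem]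
      rfl
    · simp

end ApproxList

namespace ApproxList

variable {m : ℕ} {X : Type*} {αL αR βL βR : ℝ} (L : ApproxList m X αL αR βL βR)

/-- The contribution of the accepted elements is correct when all scores are good. -/
theorem accepted_sum_mem {P : Params m} {t : ℝ} (ht : 0 < t) {H : List (Fin m)}
    (hH : 0 < H.length) {R : List X} (h : ∀ x ∈ R, L.GoodScore P t H x) :
    L.invSum (L.accepted (t / (2 * P.f₁ * m) * H.length) H R) * (1 / (1 + P.ε₁)) ≤
        ((L.accepted (t / (2 * P.f₁ * m) * H.length) H R).map
          fun x => (H.length : ℝ) / (L.score H x * m)).sum ∧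
      ((L.accepted (t / (2 * P.f₁ * m) * H.length) H R).map
          fun x => (H.length : ℝ) / (L.score H x * m)).sum ≤
        L.invSum (L.accepted (t / (2 * P.f₁ * m) * H.length) H R) * (1 / (1 - P.ε₁)) := by
  have key : ∀ x ∈ L.accepted (t / (2 * P.f₁ * m) * H.length) H R, _ := fun x hx =>
    (h x (List.mem_of_mem_filter hx)).estimate ht hH (by simpa using List.of_mem_filter hx)
  rw [invSum, ← List.sum_map_mul_right, ← List.sum_map_mul_right]
  exact ⟨List.sum_le_sum fun x hx => (key x hx).1, List.sum_le_sum fun x hx => (key x hx).2⟩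

end ApproxList

/-! ### Error propagation through the stages -/

namespace Prog

variable {m : ℕ} {X : Type*} {αL αR βL βR : ℝ}

/-- The values that deviate from `sum + s` by more than the error of `k` resampling steps and of the
scores. -/
def Wrong (P : Params m) (k : ℕ) (sum s : ℝ) : Set ℝ :=
  {v | ¬ (sum + s * ((1 - P.ε₂) ^ k * (1 / (1 + P.ε₁))) ≤ v ∧
    v ≤ sum + s * ((1 + P.ε₂) ^ k * (1 / (1 - P.ε₁))))}

/-- One resampling step changes the remaining mass by a factor in `[1 - ε₂, 1 + ε₂]`, which uses up
one of the `k + 1` factors allowed. -/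
theorem wrong_subset_of_invSum {P : Params m} {k : ℕ} {sum s s' : ℝ}
    (h1 : (1 - P.ε₂) * s ≤ s') (h2 : s' ≤ (1 + P.ε₂) * s) :
    Wrong P (k + 1) sum s ⊆ Wrong P k sum s' := by
  intro v hv hc
  refine hv ⟨le_trans ?_ hc.1, hc.2.trans ?_⟩
  · have := P.ε₁_pos; have := P.ε₂_lt
    have : 0 ≤ (1 - P.ε₂) ^ k * (1 / (1 + P.ε₁)) :=
      mul_nonneg (pow_nonneg (by linarith) _) (by positivity)
    calc _ = sum + ((1 - P.ε₂) * s) * ((1 - P.ε₂) ^ k * (1 / (1 + P.ε₁))) := by ring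
      _ ≤ _ := by gcongr
  · have := P.ε₁_lt; have := P.ε₂_pos
    have : 0 ≤ (1 + P.ε₂) ^ k * (1 / (1 - P.ε₁)) :=
      mul_nonneg (by positivity) (one_div_nonneg.2 (by linarith))
    calc _ ≤ sum + ((1 + P.ε₂) * s) * ((1 + P.ε₂) ^ k * (1 / (1 - P.ε₁))) := by gcongr
      _ = _ := by ring

variable [NeZero m] (L : ApproxList m X αL αR βL βR)

/-- With `k` resampling steps to go, the algorithm fails from thickness `t` on with probability at
most `b`. -/
def StageAccurate (P : Params m) (k : ℕ) (t b : ℝ) : Prop :=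
  ∀ (R : List X) (w sum : ℝ), 0 ≤ w → R.length ≤ P.h₁ →
    (∀ x ∈ R, (P.zmin : ℝ) ≤ L.thickness x) →
    ((stage P R t w sum).law L).toOuterMeasure (Wrong P k sum (w * L.invSum R)) ≤
      ENNReal.ofReal b

/-- The form of `ih` covers both cases: it is vacuous at the last stage, and otherwise it supplies
the accuracy of the next one. -/
theorem law_proceed_le (P : Params m) {k : ℕ} {t b : ℝ} (ht : 0 < t) (htm : t ≤ m) (hb : 0 ≤ b)
    (ih : ¬ t / P.f₁ < P.zmin → ∃ j, k = j + 1 ∧ StageAccurate L P j (t / P.f₁) b)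
    {R : List X} {w sum : ℝ} (hw : 0 ≤ w) (hR : R.length ≤ P.h₁)
    (hT : ∀ x ∈ R, (P.zmin : ℝ) ≤ L.thickness x ∧ (L.thickness x : ℝ) ≤ t / P.f₁) :
    ((proceed P t w sum R).law L).toOuterMeasure (Wrong P k sum (w * L.invSum R)) ≤
      ENNReal.ofReal (P.γ₂ + b) := by
  have hf := P.eight_le_f₁
  have ht' : 0 < t / P.f₁ := by positivity
  have hg := P.γ₂_pos
  have hsb := P.sampleBound_pos ht'
  have hsb' : P.sampleBound (t / P.f₁) ≤ P.h₁ :=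
    P.sampleBound_le ht' ((div_le_self ht.le (by linarith)).trans htm)
  by_cases hz : t / P.f₁ < P.zmin
  -- At termination a rejected element would have `z_min ≤ T ≤ t / f₁ < z_min`, so nothing is lost.
  · have hR0 : R = [] := by
      refine List.eq_nil_iff_forall_not_mem.2 fun x hx => ?_
      linarith [hT x hx]
    subst hR0
    simp only [proceed, List.length_nil, hsb, if_true, law_bind, law_ret, law_work, if_pos hz,
      PMF.pure_bind]
    rw [PMF.toOuterMeasure_pure_apply, if_neg]
    · simp
    · simp [Wrong, ApproxList.invSum]
  · obtain ⟨k, rfl, ihk⟩ := ih hz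
    by_cases hl : R.length < P.sampleBound (t / P.f₁)
    -- Without resampling the sample and its weight are unchanged, and the allowed factor is simply
    -- not used.
    · simp only [proceed, if_pos hl, law_bind, law_ret, law_work, if_neg hz, PMF.pure_bind, mul_one]
      refine (MeasureTheory.measure_mono (wrong_subset_of_invSum ?_ ?_)).trans
        ((ihk R w sum hw hR fun x hx => (hT x hx).1).trans
        (ENNReal.ofReal_le_ofReal (by linarith)))
      · nlinarith [mul_nonneg hw (L.invSum_nonneg R), P.ε₂_pos]
      · nlinarith [mul_nonneg hw (L.invSum_nonneg R), P.ε₂_pos]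
    · have hR0 : R ≠ [] := by
        rintro rfl
        exact hl (by simpa using hsb)
      have : Nonempty (Fin R.length) := ⟨⟨0, List.length_pos_of_ne_nil hR0⟩⟩
      simp only [proceed, if_neg hl, law_bind, law_ret, law_work, if_neg hz, PMF.pure_bind,
        PMF.bind_bind, law_resample L hR0]
      rw [ENNReal.ofReal_add hg.le hb]
      refine PMF.toOuterMeasure_bind_le
        (L.resample_invSum_tail P hT (P.f₄_le_sampleBound ht')) fun R' hs hR' => ?_
      rw [Set.mem_ofPred_eq, not_not] at hR'
      obtain ⟨hl', hm'⟩ := PMF.of_mem_support_iid hs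
      refine (MeasureTheory.measure_mono (wrong_subset_of_invSum ?_ ?_)).trans
        (ihk R' (w * ((R.length : ℝ) / P.sampleBound (t / P.f₁))) sum (by positivity)
          (hl'.trans_le hsb') fun x hx => ?_)
      · rw [mul_left_comm, mul_assoc]
        exact mul_le_mul_of_nonneg_left hR'.1 hw
      · rw [mul_left_comm _ w, mul_assoc w]
        exact mul_le_mul_of_nonneg_left hR'.2 hw
      · have := hm' x hx
        rw [PMF.mem_support_map_iff] at this
        obtain ⟨i, _, rfl⟩ := this
        exact (hT _ (List.get_mem _ _)).1

/-- A stage is charged `γ₂` for its scores and `γ₂` for the resampling. -/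
theorem stageAccurate_of_proceed (P : Params m) {k : ℕ} {t b : ℝ} (ht : 0 < t) (htm : t ≤ m)
    (hb : 0 ≤ b)
    (ih : ¬ t / P.f₁ < P.zmin → ∃ j, k = j + 1 ∧ StageAccurate L P j (t / P.f₁) b) :
    StageAccurate L P k t (2 * P.γ₂ + b) := by
  intro R w sum hw hR hT
  have hf := P.eight_le_f₁
  have hg := P.γ₂_pos
  rw [law_stage, two_mul P.γ₂, add_assoc, ENNReal.ofReal_add hg.le (by linarith)]
  have hbad : ((PMF.uniformOfFintype (Fin m)).iid ⌈(m : ℝ) / t * P.f₆⌉₊).toOuterMeasure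
      {H | ∃ x ∈ R, ¬ L.GoodScore P t H x} ≤ ENNReal.ofReal P.γ₂ := by
    refine (L.exists_badScore_le P ht R).trans (ENNReal.ofReal_le_ofReal
      (le_trans ?_ P.h₁_mul_γ₃_le))
    have := P.γ₃_pos
    gcongr
  refine PMF.toOuterMeasure_bind_le hbad fun H hs hH => ?_
  simp only [Set.mem_ofPred_eq, not_exists, not_and, not_not] at hH
  have hu : 0 < H.length := by
    rw [(PMF.of_mem_support_iid hs).1, Nat.ceil_pos]
    have := P.f₆_pos; have := P.two_le_cast
    positivity
  have hrej : ∀ x ∈ L.rejected (t / (2 * P.f₁ * m) * H.length) H R,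
      (P.zmin : ℝ) ≤ L.thickness x ∧ (L.thickness x : ℝ) ≤ t / P.f₁ := fun x hx =>
    have hx' := List.mem_of_mem_filter hx
    ⟨hT x hx', ((hH x hx').thickness_lt ht hu (by simpa using List.of_mem_filter hx)).le⟩
  obtain ⟨h1, h2⟩ := L.accepted_sum_mem ht hu hH
  refine (MeasureTheory.measure_mono ?_).trans (law_proceed_le L P (w := w)
    (sum := nextSum L P R t w sum H) ht htm hb ih hw ((List.length_filter_le _ _).trans hR) hrej)
  intro v hv hc
  refine hv ?_
  have he := P.ε₁_pos
  have he' := P.ε₁_lt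
  have h3 := P.ε₂_pos
  have h4 := P.ε₂_lt
  have hsplit := L.invSum_accepted_add_rejected (t / (2 * P.f₁ * m) * H.length) H R
  have hacc := L.invSum_nonneg (L.accepted (t / (2 * P.f₁ * m) * H.length) H R)
  -- Accepted elements carry only the score error. Widening it to the error of the rejected ones
  -- lets both parts be added.
  have hlo : (1 - P.ε₂) ^ k * (1 / (1 + P.ε₁)) ≤ 1 / (1 + P.ε₁) :=
    mul_le_of_le_one_left (by positivity) (pow_le_one₀ (by linarith) (by linarith))
  have hhi : 1 / (1 - P.ε₁) ≤ (1 + P.ε₂) ^ k * (1 / (1 - P.ε₁)) :=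
    le_mul_of_one_le_left (one_div_nonneg.2 (by linarith)) (one_le_pow₀ (by linarith))
  constructor
  · refine le_trans ?_ hc.1
    have := mul_le_mul_of_nonneg_left ((mul_le_mul_of_nonneg_left hlo hacc).trans h1) hw
    rw [nextSum, ← hsplit]
    linarith
  · refine hc.2.trans ?_
    have := mul_le_mul_of_nonneg_left (h2.trans (mul_le_mul_of_nonneg_left hhi hacc)) hw
    rw [nextSum, ← hsplit]
    linarith

/-- The condition on `t` says that after `k + 1` divisions by `f₁` the thickness is below `z_min`,
so at most `k` further stages follow. -/
theorem stageAccurate (P : Params m) (k : ℕ) {t : ℝ} (ht : 0 < t) (htm : t ≤ m)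
    (hk : t < P.zmin * P.f₁ ^ (k + 1)) : StageAccurate L P k t (2 * (k + 1) * P.γ₂) := by
  have hf := P.eight_le_f₁
  have hg := P.γ₂_pos
  have hk' : t / P.f₁ < P.zmin * P.f₁ ^ k := by
    rw [div_lt_iff₀ (by linarith), mul_assoc, ← pow_succ]; exact hk
  induction k generalizing t with
  | zero =>
    convert stageAccurate_of_proceed L P ht htm le_rfl fun h => absurd (by simpa using hk') h
      using 1
    push_cast; ring
  | succ k ih =>
    convert stageAccurate_of_proceed L P ht htm (b := 2 * (k + 1) * P.γ₂) (by positivity)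
      fun h => ⟨k, rfl, ih (by positivity) ((div_le_self ht.le (by linarith)).trans htm) hk' ?_⟩
      using 1
    · push_cast; ring
    · rw [div_lt_iff₀ (by linarith), mul_assoc, ← pow_succ]; exact hk'

end Prog

/-! ## The first sample -/

namespace ApproxList

variable {m : ℕ} {X : Type*} {αL αR βL βR : ℝ} (L : ApproxList m X αL αR βL βR)

theorem card_set_pos (i : Fin m) : (0 : ℝ) < (L.set i).card := by
  obtain ⟨x, hx⟩ := (L.gen i).support_nonempty
  exact_mod_cast Finset.card_pos.mpr ⟨x, (L.biased i).1 hx⟩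

theorem mem_union {x : X} : x ∈ L.union ↔ ∃ i, x ∈ L.set i := by
  classical
  simp [union]

theorem minThickness_le {x : X} (hx : x ∈ L.union) : L.minThickness ≤ L.thickness x :=
  Nat.sInf_le ⟨x, hx, rfl⟩

theorem le_maxThickness {x : X} (hx : x ∈ L.union) : L.thickness x ≤ L.maxThickness :=
  Finset.le_sup (f := L.thickness) hx

theorem thickness_pos {x : X} (hx : x ∈ L.union) : 0 < L.thickness x := by
  classical
  obtain ⟨i, hi⟩ := L.mem_union.1 hx
  exact Finset.card_pos.2 ⟨i, by simpa using hi⟩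

variable [NeZero m]

theorem mem_union_of_mem_support_choice {x : X} (hx : x ∈ L.choice.support) : x ∈ L.union := by
  rw [choice, PMF.mem_support_bind_iff] at hx
  obtain ⟨i, _, hi⟩ := hx
  exact L.mem_union.2 ⟨i, (L.biased i).1 hi⟩

theorem M_mul_choice (x : X) :
    L.M * (L.choice x).toReal = ∑ i, L.size i * (L.gen i x).toReal := by
  rw [choice, PMF.bind_apply, tsum_fintype, ENNReal.toReal_sum, Finset.mul_sum]
  · refine Finset.sum_congr rfl fun i _ => ?_
    rw [ENNReal.toReal_mul, pick, PMF.ofFintype_apply,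
      ENNReal.toReal_ofReal (div_nonneg (L.size_pos i).le L.M_pos.le)]
    have := L.M_pos
    field_simp
  · intro i _
    exact ENNReal.mul_ne_top (PMF.apply_ne_top _ _) (PMF.apply_ne_top _ _)

/-- Each set containing `x` contributes `m_i` times the probability of `x` in its generator; `|A_i|`
cancels and only the bias factors remain. -/
theorem M_mul_choice_mem (x : X) :
    L.thickness x * ((1 - αL) * (1 - βL)) ≤ L.M * (L.choice x).toReal ∧
      L.M * (L.choice x).toReal ≤ L.thickness x * ((1 + αR) * (1 + βR)) := by
  classical
  have key : ∑ i, L.size i * (L.gen i x).toReal =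
      ∑ i with x ∈ L.set i, L.size i * (L.gen i x).toReal := by
    rw [Finset.sum_filter]
    refine Finset.sum_congr rfl fun i _ => ?_
    split_ifs with h
    · rfl
    · rw [((L.gen i).apply_eq_zero_iff x).2 fun hs => h ((L.biased i).1 hs)]
      simp
  rw [L.M_mul_choice, key, thickness, ← nsmul_eq_mul, ← nsmul_eq_mul, ← Finset.sum_const,
    ← Finset.sum_const]
  have ha := L.αL_mem; have ha' := L.αR_mem; have hb := L.βL_mem; have hb' := L.βR_mem
  constructor
  · convert Finset.sum_le_sum (f := fun _ => (1 - αL) * (1 - βL)) fun i hi => ?_ using 2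
    have hx := (L.biased i).2 x (by simpa using hi)
    have hc := L.card_set_pos i
    calc (1 - αL) * (1 - βL) = (1 - βL) * (L.set i).card * ((1 - αL) / (L.set i).card) := by
          field_simp
      _ ≤ _ := mul_le_mul (L.le_size i) hx.1 (div_nonneg (by linarith [ha.2]) hc.le)
          (L.size_pos i).le
  · convert Finset.sum_le_sum (g := fun _ => (1 + αR) * (1 + βR)) fun i hi => ?_ using 2
    have hx := (L.biased i).2 x (by simpa using hi)
    have hc := L.card_set_pos i
    calc _ ≤ (1 + βR) * (L.set i).card * ((1 + αR) / (L.set i).card) :=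
          mul_le_mul (L.size_le i) hx.2 ENNReal.toReal_nonneg
            (mul_nonneg (by linarith [hb'.1]) hc.le)
      _ = _ := by field_simp

/-- The expected reciprocal thickness of a random choice. -/
def meanInv : ℝ := ∑ x ∈ L.union, (L.choice x).toReal * (1 / L.thickness x)

theorem meanInv_nonneg : 0 ≤ L.meanInv :=
  Finset.sum_nonneg fun x _ => by positivity

theorem tsum_choice_mul :
    ∑' x, L.choice x * ENNReal.ofReal (1 / L.thickness x) = ENNReal.ofReal L.meanInv := by
  rw [tsum_eq_sum (s := L.union), meanInv, ENNReal.ofReal_sum_of_nonneg fun x _ => by positivity]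
  · refine Finset.sum_congr rfl fun x _ => ?_
    rw [ENNReal.ofReal_mul (by positivity), ENNReal.ofReal_toReal (PMF.apply_ne_top _ _)]
  · intro x hx
    rw [(L.choice.apply_eq_zero_iff x).2 fun hs => hx (L.mem_union_of_mem_support_choice hs),
      zero_mul]

theorem M_mul_meanInv_mem :
    (1 - αL) * (1 - βL) * L.union.card ≤ L.M * L.meanInv ∧
      L.M * L.meanInv ≤ (1 + αR) * (1 + βR) * L.union.card := by
  rw [mul_comm _ (L.union.card : ℝ), mul_comm _ (L.union.card : ℝ), ← nsmul_eq_mul,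
    ← nsmul_eq_mul, ← Finset.sum_const, ← Finset.sum_const, meanInv, Finset.mul_sum]
  constructor
  · refine Finset.sum_le_sum fun x hx => ?_
    have h0 : (0 : ℝ) < L.thickness x := by exact_mod_cast L.thickness_pos hx
    rw [← mul_assoc, mul_one_div, le_div_iff₀ h0, mul_comm]
    exact (L.M_mul_choice_mem x).1
  · refine Finset.sum_le_sum fun x hx => ?_
    have h0 : (0 : ℝ) < L.thickness x := by exact_mod_cast L.thickness_pos hx
    rw [← mul_assoc, mul_one_div, div_le_iff₀ h0, mul_comm _ (L.thickness x : ℝ)]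
    exact (L.M_mul_choice_mem x).2

end ApproxList

/-! ### Budgets for failure probability and relative error -/

namespace Params

variable {m : ℕ} (P : Params m)

theorem log_f₁_ge : 3 * Real.log 2 ≤ Real.log P.f₁ := by
  rw [← Real.log_rpow two_pos]
  exact Real.log_le_log (by positivity) (by norm_num; exact P.eight_le_f₁)

theorem stageRatio_nonneg : 0 ≤ P.stageRatio := by
  have := Real.log_pos one_lt_two
  refine div_nonneg (Real.log_nonneg ?_) (by linarith [P.log_f₁_ge])
  rw [one_le_div (by linarith [P.one_le_zmin_cast])]
  exact P.zmin_le_zmax_cast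

theorem stageRatio_le : P.stageRatio ≤ Real.logb 2 m / 3 := by
  have h2 := Real.log_pos one_lt_two
  have hz := P.one_le_zmin_cast
  have hz' := P.zmin_le_zmax_cast
  have hm : 0 ≤ Real.log m := Real.log_nonneg (by linarith [P.two_le_cast])
  have h1 : Real.log ((P.zmax : ℝ) / P.zmin) ≤ Real.log m :=
    Real.log_le_log (div_pos (by linarith) (by linarith))
      ((div_le_self (by linarith) hz).trans P.zmax_le_cast)
  rw [Real.logb, div_div, mul_comm]
  exact div_le_div₀ hm h1 (by linarith) P.log_f₁_ge

theorem zmax_lt : (P.zmax : ℝ) < P.zmin * P.f₁ ^ (⌊P.stageRatio⌋₊ + 1) := by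
  have h2 := Real.log_pos one_lt_two
  have hz := P.one_le_zmin_cast
  have hz' := P.zmin_le_zmax_cast
  have hf := P.eight_le_f₁
  have h1 := Nat.lt_floor_add_one P.stageRatio
  rw [stageRatio, div_lt_iff₀ (by linarith [P.log_f₁_ge]), ← stageRatio] at h1
  rw [← div_lt_iff₀' (by linarith),
    ← Real.log_lt_log_iff (div_pos (by linarith) (by linarith)) (by positivity), Real.log_pow]
  push_cast
  exact h1

/-- One `γ₂` is for the first sample and two are for each of `⌊ρ⌋ + 1` stages; `ρ ≤ log m / 3` makes
this at most `(11 / 3) γ₂ log m < γ`. -/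
theorem failure_le : P.γ₂ + 2 * (⌊P.stageRatio⌋₊ + 1) * P.γ₂ ≤ P.γ := by
  have h1 := Nat.floor_le P.stageRatio_nonneg
  have h2 := P.stageRatio_le
  have h3 := P.one_le_logb
  have h4 := P.γ₂_pos
  have h5 := P.γ₂_mul_logb
  have h6 := P.γ_mem.1
  nlinarith

theorem resampling_error : (⌊P.stageRatio⌋₊ + 1) * P.ε₂ ≤ P.ε / 162 := by
  have h1 := Nat.floor_le P.stageRatio_nonneg
  have h2 := P.stageRatio_le
  have h3 := P.one_le_logb
  have h5 := P.ε₁_mul_logb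
  have h6 := P.ε₁_pos
  unfold ε₂
  nlinarith

theorem one_sub_pow_ge : 1 - P.ε / 162 ≤ (1 - P.ε₂) ^ (⌊P.stageRatio⌋₊ + 1) := by
  have h1 := one_add_mul_le_pow (a := -P.ε₂) (by linarith [P.ε₂_lt]) (⌊P.stageRatio⌋₊ + 1)
  have h2 := P.resampling_error
  push_cast at h1
  rw [← sub_eq_add_neg] at h1
  linarith

theorem ε₁_le : P.ε₁ ≤ P.ε / 54 := by
  nlinarith [P.one_le_logb, P.ε₁_mul_logb, P.ε₁_pos]

theorem lower_factor :
    1 - P.ε ≤ (1 - P.ε₂) ^ (⌊P.stageRatio⌋₊ + 1) * (1 / (1 + P.ε₁)) := by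
  have h1 := P.one_sub_pow_ge
  have h2 := P.ε₁_le
  have h3 := P.ε₁_pos
  have h4 := P.ε_mem
  rw [mul_one_div, le_div_iff₀ (by linarith)]
  nlinarith [h4.1, h4.2]

theorem upper_factor :
    (1 + P.ε₂) ^ (⌊P.stageRatio⌋₊ + 1) * (1 / (1 - P.ε₁)) ≤ 1 + P.ε := by
  have h1 := P.one_sub_pow_ge
  have h2 := P.ε₁_le
  have h3 := P.ε₁_pos
  obtain ⟨h4, h5⟩ := P.ε_mem
  have h6 := P.ε₂_pos
  set k := ⌊P.stageRatio⌋₊ + 1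
  -- Since `(1 + ε₂)(1 - ε₂) ≤ 1`, the upper bound follows from Bernoulli's lower bound for `(1 -
  -- ε₂) ^ k`.
  have h7 : (1 + P.ε₂) ^ k * (1 - P.ε₂) ^ k ≤ 1 := by
    rw [← mul_pow]
    exact pow_le_one₀ (by nlinarith [P.ε₂_lt]) (by nlinarith)
  have h8 : (1 + P.ε₂) ^ k * (1 - P.ε / 162) ≤ 1 :=
    (mul_le_mul_of_nonneg_left h1 (by positivity)).trans h7
  rw [mul_one_div, div_le_iff₀ (by linarith)]
  refine le_of_mul_le_mul_right (h8.trans ?_) (by linarith : 0 < 1 - P.ε / 162)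
  have : (1 + P.ε) * (1 - P.ε / 54) ≤ (1 + P.ε) * (1 - P.ε₁) := by gcongr
  have : (1 + P.ε) * (1 - P.ε / 54) * (1 - P.ε / 162) ≤
      (1 + P.ε) * (1 - P.ε₁) * (1 - P.ε / 162) := by
    gcongr; linarith
  -- The constant 40 comes from `1 / 54 + 1 / 162 = 2 / 81 < 1 / 40`.
  have : 1 - P.ε / 40 ≤ (1 - P.ε / 54) * (1 - P.ε / 162) := by nlinarith
  have : (1 + P.ε) * (1 - P.ε / 40) ≤ (1 + P.ε) * ((1 - P.ε / 54) * (1 - P.ε / 162)) := by gcongr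
  nlinarith

end Params

/-! ### Accuracy of the whole algorithm -/

namespace Prog

variable {m : ℕ} [NeZero m] {X : Type*} {αL αR βL βR : ℝ} (L : ApproxList m X αL αR βL βR)

theorem law_approximateUnion (P : Params m) (M : ℝ) (n₁ : ℕ) :
    (approximateUnion P M n₁ : Prog m X ℝ).law L =
      (L.choice.iid n₁).bind fun R =>
        ((stage P R P.zmax (1 / (n₁ : ℝ)) 0).law L).map fun s => s * M := by
  simp only [approximateUnion, law_work, law_bind, law_times, law_pickSet, law_ret, PMF.bind_pure,
    law_round, ← PMF.bind_bind, L.iid_pick_bind_genBatch]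
  rw [PMF.bind_bind]
  rfl

theorem approximateUnion_accurate (P : Params m) (hmin : P.zmin ≤ L.minThickness)
    (hmax : L.maxThickness ≤ P.zmax) {n₁ : ℕ} (hn : P.sampleBound P.zmax ≤ n₁) (hn' : n₁ ≤ P.h₁) :
    ((approximateUnion P L.M n₁).law L).toOuterMeasure
      (Set.Icc ((1 - P.ε) * (1 - αL) * (1 - βL) * (L.union.card : ℝ))
        ((1 + P.ε) * (1 + αR) * (1 + βR) * (L.union.card : ℝ)))ᶜ ≤ ENNReal.ofReal P.γ := by
  have hz := P.one_le_zmin_cast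
  have hz' := P.zmin_le_zmax_cast
  have hzm : (0 : ℝ) < P.zmax := by linarith
  have hM := L.M_pos
  have hg := P.γ₂_pos
  have hT : ∀ x ∈ L.choice.support,
      (P.zmin : ℝ) ≤ L.thickness x ∧ (L.thickness x : ℝ) ≤ P.zmax := fun x hx =>
    have hu := L.mem_union_of_mem_support_choice hx
    ⟨by exact_mod_cast hmin.trans (L.minThickness_le hu),
      by exact_mod_cast (L.le_maxThickness hu).trans hmax⟩
  have hn0 : (0 : ℝ) < n₁ := by exact_mod_cast (P.sampleBound_pos hzm).trans_le hn
  have hf : P.f₄ ≤ n₁ * (P.zmin / P.zmax) :=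
    (P.f₄_le_sampleBound hzm).trans (by gcongr)
  rw [law_approximateUnion]
  refine le_trans ?_ (ENNReal.ofReal_le_ofReal P.failure_le)
  rw [ENNReal.ofReal_add hg.le (by positivity)]
  refine PMF.toOuterMeasure_bind_le
    (L.iid_invSum_tail P hT L.tsum_choice_mul L.meanInv_nonneg hf) fun R hs hR => ?_
  rw [Set.mem_ofPred_eq, not_not] at hR
  obtain ⟨hl, hmem⟩ := PMF.of_mem_support_iid hs
  rw [PMF.toOuterMeasure_map_apply]
  refine (MeasureTheory.measure_mono ?_).trans
    (stageAccurate L P _ hzm P.zmax_le_cast P.zmax_lt R (1 / (n₁ : ℝ)) 0 (by positivity)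
      (hl.trans_le hn') fun x hx => (hT x (hmem x hx)).1)
  -- The first sample counts as one more resampling step, whence the exponent `⌊ρ⌋ + 1`.
  refine subset_trans ?_ (wrong_subset_of_invSum (s := L.meanInv) ?_ ?_)
  · intro v hv hc
    refine hv ?_
    obtain ⟨h1, h2⟩ := L.M_mul_meanInv_mem
    rw [zero_add, zero_add] at hc
    have hν := L.meanInv_nonneg
    have hε := P.ε_mem
    constructor
    · calc _ = (1 - P.ε) * ((1 - αL) * (1 - βL) * L.union.card) := by ring
        _ ≤ (1 - P.ε) * (L.M * L.meanInv) :=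
          mul_le_mul_of_nonneg_left h1 (by linarith [hε.2])
        _ = L.meanInv * (1 - P.ε) * L.M := by ring
        _ ≤ v * L.M := by
          gcongr
          exact (mul_le_mul_of_nonneg_left P.lower_factor hν).trans hc.1
    · calc v * L.M ≤ L.meanInv * (1 + P.ε) * L.M := by
            gcongr
            exact hc.2.trans (mul_le_mul_of_nonneg_left P.upper_factor hν)
        _ = (1 + P.ε) * (L.M * L.meanInv) := by ring
        _ ≤ (1 + P.ε) * ((1 + αR) * (1 + βR) * L.union.card) :=
          mul_le_mul_of_nonneg_left h2 (by linarith [hε.1])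
        _ = _ := by ring
  · rw [one_div_mul_eq_div, le_div_iff₀ hn0]
    linarith [hR.1]
  · rw [one_div_mul_eq_div, div_le_iff₀ hn0]
    linarith [hR.2]

end Prog

/-! ## The cost of the algorithm -/

namespace Params

variable {m : ℕ} (P : Params m)

theorem ceil_le_two_mul {a : ℝ} (h : 1 ≤ a) : (⌈a⌉₊ : ℝ) ≤ 2 * a := by
  linarith [Nat.ceil_lt_add_one (by linarith : 0 ≤ a)]

theorem indices_le {t : ℝ} (ht : 0 < t) (htm : t ≤ m) :
    (⌈(m : ℝ) / t * P.f₆⌉₊ : ℝ) ≤ 2 * (m / t * P.f₆) := by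
  refine ceil_le_two_mul ?_
  have : 1 ≤ (m : ℝ) / t := by rwa [one_le_div ht]
  nlinarith [P.one_le_f₆]

/-- Rounding up at most doubles the bound, because `h₁ t / m ≥ f₄ ≥ 1` for `t ≥ z_min`. The product
is thus independent of `t`, which gives every later stage the same cost bound. -/
theorem sampleBound_mul_le {t : ℝ} (ht : (P.zmin : ℝ) ≤ t) :
    P.sampleBound t * (m / t) ≤ 4 * P.f₅ := by
  have hz := P.one_le_zmin_cast
  have hm := P.two_le_cast
  have ht0 : 0 < t := by linarith
  have h1 : 1 ≤ (P.h₁ : ℝ) / (m / t) := by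
    rw [one_le_div (by positivity), div_le_iff₀ ht0]
    have h4 := P.f₅_mul_zmin
    have h5 : P.f₅ * P.zmin ≤ P.h₁ * t := by
      have := P.one_le_f₅
      exact mul_le_mul P.f₅_le_h₁ ht (by linarith) (by positivity)
    nlinarith [P.one_le_f₄]
  calc P.sampleBound t * (m / t) ≤ 2 * ((P.h₁ : ℝ) / (m / t)) * (m / t) := by
        gcongr; exact ceil_le_two_mul h1
    _ = 2 * P.h₁ := by field_simp
    _ ≤ _ := by linarith [P.h₁_le]

theorem div_le_f₅ {t : ℝ} (ht : (P.zmin : ℝ) ≤ t) : (m : ℝ) / t ≤ P.f₅ := by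
  have hz := P.one_le_zmin_cast
  have hm := P.two_le_cast
  rw [div_le_iff₀ (by linarith)]
  nlinarith [P.f₅_mul_zmin, P.one_le_f₄, P.one_le_f₅]

end Params

namespace Prog

variable {m : ℕ} [NeZero m] {X : Type*} {αL αR βL βR : ℝ} {L : ApproxList m X αL αR βL βR}

theorem bounded_proceed {P : Params m} {t w sum T r : ℝ} {rest : List X}
    (hh : 0 < P.sampleBound (t / P.f₁)) (hT : 0 ≤ T) (hr : 0 ≤ r)
    (ih : ¬ t / P.f₁ < P.zmin → ∀ (R : List X) (w' sum' : ℝ),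
      R.length ≤ P.sampleBound (t / P.f₁) →
      Bounded L (stage P R (t / P.f₁) w' sum') (fun _ => True) T r) :
    Bounded L (proceed P t w sum rest) (fun _ => True)
      (2 * P.sampleBound (t / P.f₁) + 3 + T) r := by
  set h := P.sampleBound (t / P.f₁) with hdef
  have h1 : Bounded L (if rest.length < h then ret (rest, (1 : ℝ))
      else (resample rest h).bind fun R' => work 1 <| ret (R', (rest.length : ℝ) / h))
      (fun Ra => Ra.1.length ≤ h) (2 * h + 1) 0 := by
    split_ifs with hl
    · exact (bounded_ret (Q := fun Ra : List X × ℝ => Ra.1.length ≤ h) hl.le).mono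
        (fun _ h => h) (by positivity) le_rfl
    · have hne : rest ≠ [] := by rintro rfl; exact hl (by simpa using hh)
      refine ((bounded_resample hne h).bind (Q' := fun Ra : List X × ℝ => Ra.1.length ≤ h)
        fun R' hR' => (bounded_ret (Q := fun Ra : List X × ℝ => Ra.1.length ≤ h)
          hR'.1.le).work 1).mono (fun _ h => h) ?_ (add_zero 0).le
      push_cast; linarith
  refine (h1.bind (Q' := fun _ => True) (t' := 2 + T) (r' := r) fun Ra hRa => ?_).mono
    (fun _ h => h) (by linarith) (zero_add r).le
  have : Bounded L (if t / P.f₁ < P.zmin then ret sum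
      else stage P Ra.1 (t / P.f₁) (w * Ra.2) sum) (fun _ => True) T r := by
    split_ifs with hz
    · exact (bounded_ret trivial).mono (fun _ h => h) hT hr
    · exact ih hz _ _ _ hRa
  exact_mod_cast this.work 2

/-- Preparing, asking and counting the queries cost `N * u` each. The constant 20 collects the fixed
work: 4 at the start, then 5, 3 and 5, and 3 when the sample is shrunk. -/
theorem bounded_stage {P : Params m} {R : List X} {t w sum N T r : ℝ} {u : ℕ}
    (hu : ⌈(m : ℝ) / t * P.f₆⌉₊ = u) (hR : (R.length : ℝ) ≤ N)
    (hh : 0 < P.sampleBound (t / P.f₁)) (hT : 0 ≤ T) (hr : 0 ≤ r)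
    (ih : ¬ t / P.f₁ < P.zmin → ∀ (R : List X) (w' sum' : ℝ),
      R.length ≤ P.sampleBound (t / P.f₁) →
      Bounded L (stage P R (t / P.f₁) w' sum') (fun _ => True) T r) :
    Bounded L (stage P R t w sum) (fun _ => True)
      (20 + 2 * u + 3 * (N * u) + 6 * N + 2 * P.sampleBound (t / P.f₁) + T) (1 + r) := by
  rw [stage, hu]
  have hH : Bounded L (times (uniform m ret) u : Prog m X _) (fun H => H.length = u)
      (2 * u) 0 := by
    refine (Bounded.times (L := L) (Q := fun _ => True) (t := 1) ((Bounded.uniform (t := 0)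
      fun i => bounded_ret trivial).mono (fun _ h => h) (add_zero 1).le le_rfl) u).mono
      (fun _ h => h.1) (by linarith) le_rfl
  refine ((hH.bind (Q' := fun _ => True)
    (t' := 3 * (R.length * u) + (16 + 6 * R.length + 2 * P.sampleBound (t / P.f₁) + T))
    (r' := 1 + r) fun H hH => ?_).work 4).mono (fun _ h => h) ?_ (zero_add _).le
  · refine ((Bounded.round (t := R.length * u +
      (16 + 6 * R.length + 2 * P.sampleBound (t / P.f₁) + T)) (r := r) fun xs _ => ?_).work
      (R.length * H.length)).mono (fun _ h => h) ?_ le_rfl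
    · dsimp only
      rw [L.zip_answers]
      refine ((Bounded.work (Bounded.work (Bounded.work
        (t := 2 * P.sampleBound (t / P.f₁) + 3 + T) (r := r) ?_ _) _) _).work _).mono
        (fun _ h => h) ?_ le_rfl
      · have := bounded_proceed (L := L) (w := w)
          (sum := nextSum L P R t w sum H)
          (rest := L.rejected (t / (2 * P.f₁ * m) * H.length) H R) hh hT hr ih
        simp only [List.filter_map, List.map_map, Function.comp_def, List.map_id', dite_eq_ite]
        simp only [proceed, nextSum, ApproxList.accepted, ApproxList.rejected] at this
        convert this using 2
        congr!
      · have hV : ∀ q : X × ℕ → Bool, (((R.map fun x => (x, L.score H x)).filter q).length : ℝ) ≤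
            R.length := fun q => by
          exact_mod_cast (List.length_filter_le _ _).trans (List.length_map _).le
        push_cast
        rw [hH]
        linarith [hV fun p => decide (t / (2 * P.f₁ * m) * u ≤ (p.2 : ℝ))]
    · simp only [List.map_map, Function.comp_def, List.length_nil, zero_add, List.map_const',
        List.sum_replicate, smul_eq_mul]
      push_cast
      rw [hH]
      linarith
  · push_cast
    have : (R.length : ℝ) * u ≤ N * u := by gcongr
    linarith

/-- The first of these stages is charged for its own size `N`. Every later one has `N * (m / t) ≤ 4
f₅` and `N ≤ 4 f₅`, hence cost at most `(28 + 24 + 24) f₅ f₆`. -/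
theorem bounded_stages (P : Params m) (k : ℕ) {t : ℝ} (ht : (P.zmin : ℝ) ≤ t) (htm : t ≤ m)
    (hk : t < P.zmin * P.f₁ ^ (k + 1)) {N : ℝ} (R : List X) (w sum : ℝ) (hR : (R.length : ℝ) ≤ N) :
    Bounded L (stage P R t w sum) (fun _ => True)
      (28 * (P.f₅ * P.f₆) + 6 * (N * (m / t)) * P.f₆ + 6 * N + k * (76 * (P.f₅ * P.f₆)))
      (k + 1) := by
  have hf := P.eight_le_f₁
  have hz := P.one_le_zmin_cast
  have hm := P.two_le_cast
  have h5 := P.one_le_f₅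
  have h6 := P.one_le_f₆
  have ht0 : 0 < t := by linarith
  have ht' : 0 < t / P.f₁ := by positivity
  have htm' : t / P.f₁ ≤ m := (div_le_self ht0.le (by linarith)).trans htm
  have h56 : P.f₅ ≤ P.f₅ * P.f₆ := le_mul_of_one_le_right (by linarith) h6
  have hN : 0 ≤ N := le_trans (by positivity) hR
  have hu := P.indices_le ht0 htm
  have hu' : (m : ℝ) / t * P.f₆ ≤ P.f₅ * P.f₆ := by gcongr; exact P.div_le_f₅ ht
  have hh : (P.sampleBound (t / P.f₁) : ℝ) ≤ 2 * P.f₅ :=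
    le_trans (by exact_mod_cast P.sampleBound_le ht' htm') P.h₁_le
  have hNu : N * (⌈(m : ℝ) / t * P.f₆⌉₊ : ℝ) ≤ 2 * ((N * (m / t)) * P.f₆) := by
    calc _ ≤ N * (2 * (m / t * P.f₆)) := by gcongr
      _ = _ := by ring
  have hk' : t / P.f₁ < P.zmin * P.f₁ ^ k := by
    rw [div_lt_iff₀ (by linarith), mul_assoc, ← pow_succ]; exact hk
  induction k generalizing t N R w sum with
  | zero =>
    refine (bounded_stage rfl hR (P.sampleBound_pos ht') le_rfl le_rfl
      fun h => absurd (by simpa using hk') h).mono (fun _ h => h) ?_ (by simp)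
    push_cast; linarith
  | succ k ih =>
    refine (bounded_stage (T := (k + 1) * (76 * (P.f₅ * P.f₆))) (r := k + 1) rfl hR
      (P.sampleBound_pos ht') (by positivity) (by positivity) fun h R' w' sum' hR' => ?_).mono
      (fun _ h => h) ?_ (by push_cast; linarith)
    · have h := not_lt.1 h
      have ht'' : 0 < t / P.f₁ / P.f₁ := by positivity
      have htm'' : t / P.f₁ / P.f₁ ≤ m := (div_le_self ht'.le (by linarith)).trans htm'
      have hR'' : (R'.length : ℝ) ≤ P.sampleBound (t / P.f₁) := by exact_mod_cast hR'
      have hb := P.sampleBound_mul_le h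
      have hb0 : (P.sampleBound (t / P.f₁) : ℝ) ≤ 4 * P.f₅ := by linarith
      refine (ih h htm' hk' R' w' sum' hR'' ht' ht'' htm'' (by positivity)
        (P.indices_le ht' htm') ?_ ?_ ?_ ?_).mono (fun _ h => h) ?_ le_rfl
      · gcongr; exact P.div_le_f₅ h
      · exact le_trans (by exact_mod_cast P.sampleBound_le ht'' htm'') P.h₁_le
      · calc _ ≤ (P.sampleBound (t / P.f₁) : ℝ) * (2 * (m / (t / P.f₁) * P.f₆)) := by
              gcongr; exact P.indices_le ht' htm'
          _ = _ := by ring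
      · rw [div_lt_iff₀ (by linarith), mul_assoc, ← pow_succ]; exact hk'
      · have : (P.sampleBound (t / P.f₁) : ℝ) * (m / (t / P.f₁)) * P.f₆ ≤ 4 * P.f₅ * P.f₆ := by
          gcongr
        linarith
    · push_cast; linarith

theorem bounded_approximateUnion (P : Params m) {n₁ : ℕ} (hn' : n₁ ≤ P.h₁) :
    Bounded L (approximateUnion P L.M n₁) (fun _ => True)
      (153 * (P.f₅ * P.f₆) + 6 * (n₁ * (m / P.zmax)) * P.f₆ +
        P.stageRatio * (76 * (P.f₅ * P.f₆))) (P.stageRatio + 2) := by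
  have hz := P.one_le_zmin_cast
  have h5 := P.one_le_f₅
  have h6 := P.one_le_f₆
  have h56 : P.f₅ ≤ P.f₅ * P.f₆ := le_mul_of_one_le_right (by linarith) h6
  have hk := Nat.floor_le P.stageRatio_nonneg
  have hn : (n₁ : ℝ) ≤ 2 * P.f₅ := le_trans (by exact_mod_cast hn') P.h₁_le
  have hpick : Bounded L (times (pickSet ret) n₁ : Prog m X _) (fun is => is.length = n₁)
      (2 * n₁) 0 := by
    refine (Bounded.times (L := L) (Q := fun _ => True) (t := 1) ((Bounded.pickSet (t := 0)
      fun i => bounded_ret trivial).mono (fun _ h => h) (add_zero 1).le le_rfl) n₁).mono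
      (fun _ h => h.1) (by linarith) le_rfl
  refine ((hpick.bind (Q' := fun _ => True) fun is his => (Bounded.round
    (t := 28 * (P.f₅ * P.f₆) + 6 * (n₁ * (m / P.zmax)) * P.f₆ + 6 * n₁ +
      ⌊P.stageRatio⌋₊ * (76 * (P.f₅ * P.f₆)) + 1) (r := ⌊P.stageRatio⌋₊ + 1)
    fun xs hxs => ?_).mono (t' := n₁ + (28 * (P.f₅ * P.f₆) + 6 * (n₁ * (m / P.zmax)) * P.f₆ +
      6 * n₁ + ⌊P.stageRatio⌋₊ * (76 * (P.f₅ * P.f₆)) + 1)) (fun _ h => h) ?_ le_rfl).work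
    100).mono (fun _ h => h) ?_ ?_
  · refine ((bounded_stages P ⌊P.stageRatio⌋₊ P.zmin_le_zmax_cast P.zmax_le_cast P.zmax_lt
      (N := n₁) xs _ _ ?_).bind (Q' := fun _ => True) fun s _ =>
      (bounded_ret trivial).work 1).mono (fun _ h => h) ?_ ?_
    · rw [L.length_of_mem_support_genBatch hxs, his]
    · push_cast; linarith
    · linarith
  · simp [his]
  · have : (⌊P.stageRatio⌋₊ : ℝ) * (76 * (P.f₅ * P.f₆)) ≤
        P.stageRatio * (76 * (P.f₅ * P.f₆)) := by gcongr
    push_cast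
    linarith
  · linarith

end Prog

end

/-! ### Main theorem -/

theorem mainTheorem1 :
    ∃ C : ℝ, 0 < C ∧
      ∀ (m : ℕ) [NeZero m] (X : Type*) (αL αR βL βR : ℝ) (L : ApproxList m X αL αR βL βR)
        (P : Params m), P.zmin ≤ L.minThickness → L.maxThickness ≤ P.zmax →
      ∀ n₁ : ℕ, P.sampleBound P.zmax ≤ n₁ → n₁ ≤ P.h₁ →
        -- accuracy
        ENNReal.ofReal (1 - P.γ) ≤
          (((Prog.approximateUnion P L.M n₁).run L).map Outcome.value).toMeasure
            (Set.Icc ((1 - P.ε) * (1 - αL) * (1 - βL) * (L.union.card : ℝ))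
              ((1 + P.ε) * (1 + αR) * (1 + βR) * (L.union.card : ℝ))) ∧
        ∀ o ∈ ((Prog.approximateUnion P L.M n₁).run L).support,
          -- number of rounds
          (o.rounds : ℝ) ≤ C * max 1 P.stageRatio ∧
          -- running time
          (o.time : ℝ) ≤ C * (m * P.f₄ * P.f₆ / P.zmin * max ((m : ℝ) / P.zmax) P.stageRatio) ∧
          (n₁ = P.sampleBound P.zmax →
            (o.time : ℝ) ≤ C * (m * P.f₄ * P.f₆ / P.zmin * max 1 P.stageRatio)) := by
  -- The running time needs at most `153 + 12 + 76` for general `n₁` and `153 + 24 + 76` for the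
  -- least `n₁`; the rounds need only 3.
  refine ⟨300, by norm_num, fun m _ X αL αR βL βR L P hmin hmax n₁ hn hn' => ⟨?_, ?_⟩⟩
  · have h := Prog.approximateUnion_accurate L P hmin hmax hn hn'
    rw [← PMF.toMeasure_apply_eq_toOuterMeasure_apply _ measurableSet_Icc.compl,
      MeasureTheory.prob_compl_eq_one_sub measurableSet_Icc] at h
    rw [ENNReal.ofReal_sub _ P.γ_mem.1.le, ENNReal.ofReal_one]
    exact tsub_le_iff_tsub_le.1 h
  · intro o ho
    obtain ⟨-, ht, hr⟩ := Prog.bounded_approximateUnion (L := L) P hn' o ho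
    have hz := P.one_le_zmin_cast
    have hz' := P.zmin_le_zmax_cast
    have hρ := P.stageRatio_nonneg
    have h5 := P.one_le_f₅
    have h6 := P.one_le_f₆
    have h0 : 0 < P.f₅ * P.f₆ := by positivity
    have e : m * P.f₄ * P.f₆ / P.zmin = P.f₅ * P.f₆ := by unfold Params.f₅; ring
    have hs : 1 ≤ (m : ℝ) / P.zmax := by
      rw [one_le_div (by linarith)]; exact P.zmax_le_cast
    rw [e]
    refine ⟨?_, ?_, fun hn1 => ?_⟩
    · linarith [le_max_left 1 P.stageRatio, le_max_right 1 P.stageRatio]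
    · have h1 := mul_le_mul_of_nonneg_left (le_max_left ((m : ℝ) / P.zmax) P.stageRatio) h0.le
      have h2 := mul_le_mul_of_nonneg_left (le_max_right ((m : ℝ) / P.zmax) P.stageRatio) h0.le
      have h3 : P.f₅ * P.f₆ * 1 ≤ P.f₅ * P.f₆ * (m / P.zmax) := by gcongr
      have h4 : n₁ * ((m : ℝ) / P.zmax) * P.f₆ ≤ 2 * P.f₅ * (m / P.zmax) * P.f₆ := by
        gcongr
        exact le_trans (by exact_mod_cast hn') P.h₁_le
      nlinarith
    · have h1 := mul_le_mul_of_nonneg_left (le_max_left 1 P.stageRatio) h0.le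
      have h2 := mul_le_mul_of_nonneg_left (le_max_right 1 P.stageRatio) h0.le
      have h4 : n₁ * ((m : ℝ) / P.zmax) * P.f₆ ≤ 4 * P.f₅ * P.f₆ := by
        rw [hn1]
        exact mul_le_mul_of_nonneg_right (P.sampleBound_mul_le hz') (by linarith)
      linarith
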